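/- Let $\mathfrak g$ be a (finite-dimensional) complex simple Lie algebra with Cartan subalgebra $\mathfrak h$, root system $R\subset\mathfrak h^*$, a choice of positive roots $R_+$, $\rho=\frac12\sum_{\mu\in R_+}\mu$, and maximal root $\lambda_{ad}$ (the highest weight of the adjoint representation). Let $\langle\,,\rangle$ be the form on $\mathfrak h^*$ induced by the restriction of the Killing form to $\mathfrak h$. Let $\alpha,\beta,\gamma$ be Vogel's parameters of $\mathfrak g$, given according to the type of $\mathfrak g$ by $$\begin{array}{c|ccc} & \alpha&\beta&\gamma\\ \hline A_n\ (n\ge1)&-2&2&n+1\\ B_n\ (n\ge2)&-2&4&2n-3\\ C_n\ (n\ge2)&-2&1&n+2\\ D_n\ (n\ge3)&-2&4&2n-4\\ G_2&-2&10/3&8/3\\ F_4&-2&5&6\\ E_6&-2&6&8\\ E_7&-2&8&12\\ E_8&-2&12&20\end{array}$$ and put $t=\alpha+\beta+\gamma$, $t_2=\alpha^2+\beta^2+\gamma^2$, $t_3=\alpha^3+\beta^3+\gamma^3$. For $k\ge 0$ let $$\hat C_{2k}=\sum_{\mu\in R}\left[\langle\lambda_{ad}+\rho,\mu\rangle^{2k}-\langle\rho,\mu\rangle^{2k}\right].$$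 Then: 1. For all $z$ in a neighbourhood of $0$, the series $\hat C(z)=\sum_{k=0}^\infty\hat C_{2k}z^k$ converges and $$\hat C(z)=-2z\frac{d}{dz}\ln U(z),\qquad U(z)=\frac{(16t^2-(2t-\alpha)^2z)(16t^2-(2t-\beta)^2z)(16t^2-(2t-\gamma)^2z)}{(16t^2-\alpha^2z)(16t^2-\beta^2z)(16t^2-\gamma^2z)}.$$ 2. $\hat C_2=1$ and $\hat C_4=\dfrac{2t^3+3t\,t_2-t_3}{16t^3}$. 3. Let $(\,,)$ be the multiple of $\langle\,,\rangle$ with $(\lambda_{ad},\lambda_{ad})=2$. As $z\to\infty$, both $$\prod_{\mu\in R_+}\frac{1-(\lambda_{ad}+\rho,\mu)^2z}{1-(\rho,\mu)^2z}$$ and $U(z)$ tend to $(\dim\mathfrak g)^2$, and $$\dim\mathfrak g=\frac{(\alpha-2t)(\beta-2t)(\gamma-2t)}{\alpha\beta\gamma}.$$ -/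

import Mathlib

open Module

namespace UniversalCasimir

/-- The types in the Cartan-Killing list of complex simple Lie algebras. The ranges of the ranks
are those of Bourbaki's plates. -/
inductive SimpleType where
  | A (n : ℕ) (hn : 1 ≤ n)
  | B (n : ℕ) (hn : 2 ≤ n)
  | C (n : ℕ) (hn : 2 ≤ n)
  | D (n : ℕ) (hn : 3 ≤ n)
  | G₂
  | F₄
  | E₆
  | E₇
  | E₈

namespace SimpleType

/-- The rank of a type. -/
def rank : SimpleType → ℕ
  | A n _ => n
  | B n _ => n
  | C n _ => n
  | D n _ => n
  | G₂ => 2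
  | F₄ => 4
  | E₆ => 6
  | E₇ => 7
  | E₈ => 8

/-- The Cartan matrix of a type, with the convention that the `(i, j)` entry is the value of the
`i`-th simple root on the `j`-th simple coroot. -/
def cartanMatrix : (X : SimpleType) → Matrix (Fin X.rank) (Fin X.rank) ℤ
  | A n _ => CartanMatrix.A n
  | B n _ => CartanMatrix.B n
  | C n _ => CartanMatrix.C n
  | D n _ => CartanMatrix.D n
  | G₂ => CartanMatrix.G₂
  | F₄ => CartanMatrix.F₄
  | E₆ => CartanMatrix.E₆
  | E₇ => CartanMatrix.E₇
  | E₈ => CartanMatrix.E₈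

/-- Vogel's parameter `α`, in the normalisation where the maximal root has square `2`. -/
def vogelα : SimpleType → ℂ := fun _ => -2

/-- Vogel's parameter `β`. -/
noncomputable def vogelβ : SimpleType → ℂ
  | A _ _ => 2
  | B _ _ => 4
  | C _ _ => 1
  | D _ _ => 4
  | G₂ => 10 / 3
  | F₄ => 5
  | E₆ => 6
  | E₇ => 8
  | E₈ => 12

/-- Vogel's parameter `γ`. -/
noncomputable def vogelγ : SimpleType → ℂ
  | A n _ => (n : ℂ) + 1
  | B n _ => 2 * (n : ℂ) - 3
  | C n _ => (n : ℂ) + 2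
  | D n _ => 2 * (n : ℂ) - 4
  | G₂ => 8 / 3
  | F₄ => 6
  | E₆ => 8
  | E₇ => 12
  | E₈ => 20

end SimpleType

/-- `16t² - (2t-α)²z` and its analogues over `16t² - α²z` and its analogues, where
`t = α + β + γ`. -/
noncomputable def universalRatio (α β γ z : ℂ) : ℂ :=
  ((16 * (α + β + γ) ^ 2 - (2 * (α + β + γ) - α) ^ 2 * z) *
    (16 * (α + β + γ) ^ 2 - (2 * (α + β + γ) - β) ^ 2 * z) *
    (16 * (α + β + γ) ^ 2 - (2 * (α + β + γ) - γ) ^ 2 * z)) /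
  ((16 * (α + β + γ) ^ 2 - α ^ 2 * z) *
    (16 * (α + β + γ) ^ 2 - β ^ 2 * z) *
    (16 * (α + β + γ) ^ 2 - γ ^ 2 * z))

section RootSystem

variable {𝔤 : Type*} [LieRing 𝔤] [LieAlgebra ℂ 𝔤] [FiniteDimensional ℂ 𝔤]
  [LieAlgebra.IsSimple ℂ 𝔤] {𝔥 : LieSubalgebra ℂ 𝔤} [𝔥.IsCartanSubalgebra]

/-- The form on `𝔥*` induced by the restriction of the Killing form of `𝔤` to `𝔥`. -/
noncomputable def canonicalForm (φ ψ : Dual ℂ 𝔥) : ℂ :=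
  killingForm ℂ 𝔤 ((LieAlgebra.IsKilling.cartanEquivDual 𝔥).symm φ)
    ((LieAlgebra.IsKilling.cartanEquivDual 𝔥).symm ψ)

variable (b : (LieAlgebra.IsKilling.rootSystem 𝔥).Base)

/-- The root system has type `X`: its Cartan matrix is that of `X`, up to numbering the simple
roots. -/
def HasType (X : SimpleType) : Prop :=
  ∃ e : b.support ≃ Fin X.rank, ∀ i j, b.cartanMatrix i j = X.cartanMatrix (e i) (e j)

/-- The root with index `θ` is maximal for the order in which `μ ≤ ν` when `ν - μ` is a sum of
simple roots. -/
def IsMaximalRoot (θ : 𝔥.root) : Prop :=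
  ∀ i : 𝔥.root,
    (LieAlgebra.IsKilling.rootSystem 𝔥).root i - (LieAlgebra.IsKilling.rootSystem 𝔥).root θ ∈
      AddSubmonoid.closure ((LieAlgebra.IsKilling.rootSystem 𝔥).root '' b.support) → i = θ

open Classical in
/-- The half-sum of the positive roots. -/
noncomputable def rho : Dual ℂ 𝔥 :=
  (1 / 2 : ℂ) • ∑ i : 𝔥.root with b.IsPos i, (LieAlgebra.IsKilling.rootSystem 𝔥).root i

/-- The number `∑ (⟨lam + ρ, μ⟩ ^ (2k) - ⟨ρ, μ⟩ ^ (2k))`, the sum being over all roots `μ`. -/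
noncomputable def casimir (lam : Dual ℂ 𝔥) (k : ℕ) : ℂ :=
  ∑ i : 𝔥.root,
    (canonicalForm (lam + rho b) ((LieAlgebra.IsKilling.rootSystem 𝔥).root i) ^ (2 * k) -
      canonicalForm (rho b) ((LieAlgebra.IsKilling.rootSystem 𝔥).root i) ^ (2 * k))

/-- The multiple of the canonical form for which the root with index `θ` has square `2`. -/
noncomputable def minimalForm (θ : 𝔥.root) (φ ψ : Dual ℂ 𝔥) : ℂ :=
  2 / canonicalForm ((LieAlgebra.IsKilling.rootSystem 𝔥).root θ)
      ((LieAlgebra.IsKilling.rootSystem 𝔥).root θ) * canonicalForm φ ψ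

open Classical in
/-- The product of `(1 - (lam + ρ, μ)² z) / (1 - (ρ, μ)² z)` over the positive roots `μ`, for a
form `( , )` on `𝔥*`. -/
noncomputable def rootRatio (form : Dual ℂ 𝔥 → Dual ℂ 𝔥 → ℂ) (lam : Dual ℂ 𝔥) (z : ℂ) : ℂ :=
  ∏ i : 𝔥.root with b.IsPos i,
    (1 - form (lam + rho b) ((LieAlgebra.IsKilling.rootSystem 𝔥).root i) ^ 2 * z) /
      (1 - form (rho b) ((LieAlgebra.IsKilling.rootSystem 𝔥).root i) ^ 2 * z)

end RootSystem

end UniversalCasimir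

namespace UniversalCasimir

/-! ### The canonical form, the half-sum of the positive roots and the dimension. -/

section LieAlgebra

open LieAlgebra LieAlgebra.IsKilling

variable {𝔤 : Type*} [LieRing 𝔤] [LieAlgebra ℂ 𝔤] [FiniteDimensional ℂ 𝔤]
  [LieAlgebra.IsSimple ℂ 𝔤] {𝔥 : LieSubalgebra ℂ 𝔤} [𝔥.IsCartanSubalgebra]

/-! Let `( , )` be the form with `(θ, θ) = 2`, let `λ` be the highest root, and let `μ` run over the
positive roots. The families `(λ + ρ, μ)` and `(ρ, μ)` nearly coincide: after adjoining `-α/2 = 1`,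
`β/2`, `γ/2` to the first and `(2t-α)/2`, `(2t-β)/2`, `(2t-γ)/2` to the second they are the same
multiset. Indeed adding `λ` moves only the values at roots not orthogonal to `λ`, and in the
classical types the moved values telescope along rows of roots. This is the field `shift` of
`PositiveRootModel`, the heart of the matter.

Hence every sum over the positive roots of `f(λ + ρ, μ) - f(ρ, μ)`, and every analogous quotient of
products, collapses to three terms. It remains to compare `( , )` with the canonical form, say `⟨ ,
⟩ = k₀ ( , )`. Since `⟨φ, ψ⟩` is the sum of `⟨φ, μ⟩⟨ψ, μ⟩` over all roots, computing `⟨λ+ρ, λ+ρ⟩ -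
⟨ρ, ρ⟩` in two ways gives `2tk₀ = (2tk₀)²`, so `k₀ = 1/(2t)`. Then `U` is a product of three
fractions `(1 - az)/(1 - bz)`, whose logarithmic derivative is a sum of geometric series with the
coefficients sought. Both limits at infinity are the square of the collapsed product. The dimension
is rank plus number of roots, compared with the rational expression in each type; Weyl's dimension
formula is not needed.

The type is given only through the Cartan matrix, so the explicit description of the roots must be
carried to the abstract root system: this is `PositiveRootModel.exists_labelling`, and
`PositiveRootModel.universal` draws the consequences. The models are coordinate vectors in the
classical types, where `shift` is a telescoping sum, and finite tables checked by evaluation in the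
exceptional ones. -/

theorem canonicalForm_eq_apply (φ ψ : Dual ℂ 𝔥) :
    canonicalForm φ ψ = φ ((cartanEquivDual 𝔥).symm ψ) := by
  conv_rhs => rw [← (cartanEquivDual 𝔥).apply_symm_apply φ]
  rw [cartanEquivDual_apply_apply]
  rfl

theorem canonicalForm_comm (φ ψ : Dual ℂ 𝔥) : canonicalForm φ ψ = canonicalForm ψ φ :=
  LieModule.traceForm_comm ℂ 𝔤 𝔤 _ _

/-- The trace of `ad x ∘ ad y`, for `x` and `y` in `𝔥`, is read off on the root spaces. This
identity is what fixes the scale of the canonical form later. -/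
theorem canonicalForm_eq_sum (φ ψ : Dual ℂ 𝔥) :
    canonicalForm φ ψ = ∑ i : 𝔥.root, canonicalForm φ ((rootSystem 𝔥).root i) *
      canonicalForm ψ ((rootSystem 𝔥).root i) := by
  have h := LinearMap.congr_fun₂ (restrict_killingForm_eq_sum (H := 𝔥))
    ((cartanEquivDual 𝔥).symm φ) ((cartanEquivDual 𝔥).symm ψ)
  have h' : canonicalForm φ ψ = ((killingForm ℂ 𝔤).restrict 𝔥)
    ((cartanEquivDual 𝔥).symm φ) ((cartanEquivDual 𝔥).symm ψ) := rfl
  rw [h', h, LinearMap.sum_apply, LinearMap.sum_apply, ← Finset.sum_coe_sort]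
  refine Finset.sum_congr rfl fun i _ ↦ ?_
  rw [canonicalForm_comm φ, canonicalForm_comm ψ, canonicalForm_eq_apply, canonicalForm_eq_apply]
  rfl

theorem apply_coroot_mul_canonicalForm (φ : Dual ℂ 𝔥) (i : 𝔥.root) :
    φ ((rootSystem 𝔥).coroot i) *
      canonicalForm ((rootSystem 𝔥).root i) ((rootSystem 𝔥).root i) =
      2 * canonicalForm φ ((rootSystem 𝔥).root i) := by
  have h := root_apply_cartanEquivDual_symm_ne_zero (𝔥.isNonZero_coe_root i)
  simp only [canonicalForm_eq_apply, rootSystem_coroot_apply, rootSystem_root_apply, coroot,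
    map_nsmul, map_smul, smul_eq_mul, nsmul_eq_mul, LieModule.Weight.toLinear_apply]
  field_simp
  push_cast
  ring

theorem canonicalForm_root_ne_zero (i : 𝔥.root) :
    canonicalForm ((rootSystem 𝔥).root i) ((rootSystem 𝔥).root i) ≠ 0 := by
  rw [canonicalForm_eq_apply]
  exact root_apply_cartanEquivDual_symm_ne_zero (𝔥.isNonZero_coe_root i)

-- The simple reflection `s_j` permutes the positive roots other than `α_j` and changes the sign of
-- their pairing with the `j`-th coroot, so only `α_j` itself contributes to the sum.
open Classical in
theorem rho_coroot (b : (rootSystem 𝔥).Base) {j : 𝔥.root} (hj : j ∈ b.support) :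
    rho b ((rootSystem 𝔥).coroot j) = 1 := by
  let P := rootSystem 𝔥
  let S := Finset.univ.filter fun i ↦ b.IsPos i
  have hjS : j ∈ S := by simpa [S] using b.isPos_of_mem_support hj
  have h0 : ∑ i ∈ S.erase j, P.pairing i j = 0 := by
    have h1 : ∑ i ∈ S.erase j, P.pairing i j = ∑ i ∈ S.erase j, -(P.pairing i j) := by
      have hmem : ∀ i ∈ S.erase j, P.reflectionPerm j i ∈ S.erase j := by
        intro i hi
        simp only [Finset.mem_erase, S, Finset.mem_filter, Finset.mem_univ, true_and] at hi ⊢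
        refine ⟨fun h ↦ ?_, hi.2.reflectionPerm hj hi.1⟩
        -- If `s_j` sent `i` to `α_j`, then `i` would be `-α_j`, of negative height.
        have h3 : i = P.reflectionPerm j j := by rw [← P.reflectionPerm_self (i := j) (j := i), h]
        have h4 : b.height (P.reflectionPerm j j) = - b.height j :=
          b.height_reflectionPerm_self j
        have h5 := b.isPos_iff.mp hi.2
        have h6 := b.isPos_iff.mp (b.isPos_of_mem_support hj)
        rw [h3] at h5
        lia
      refine Finset.sum_nbij' (P.reflectionPerm j) (P.reflectionPerm j) hmem hmem
        (fun i _ ↦ by simp) (fun i _ ↦ by simp) (fun i _ ↦ ?_)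
      rw [← P.pairing_reflectionPerm, P.pairing_reflectionPerm_self_right, neg_neg]
    rw [Finset.sum_neg_distrib] at h1
    linear_combination (1 / 2 : ℂ) * h1
  have h2 : rho b (P.coroot j) = (1 / 2 : ℂ) • ∑ i ∈ S, P.pairing i j := by
    rw [rho, LinearMap.smul_apply, LinearMap.sum_apply]
    rfl
  change rho b (P.coroot j) = 1
  rw [h2, ← Finset.add_sum_erase S _ hjS, h0, P.pairing_same]
  norm_num

/-- Root space decomposition: the zero weight space is `𝔥`, with the simple coroots as a basis, and
each root space is a line. The dimensions are added by taking the trace of the identity. -/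
theorem finrank_eq_card_add_card (b : (rootSystem 𝔥).Base) :
    finrank ℂ 𝔤 = Fintype.card b.support + Fintype.card 𝔥.root := by
  classical
  have : Nontrivial 𝔤 := by
    by_contra h
    rw [not_nontrivial_iff_subsingleton] at h
    exact LieAlgebra.IsSimple.non_abelian ℂ (L := 𝔤) ⟨fun x y ↦ Subsingleton.elim _ _⟩
  have hds := DirectSum.isInternal_submodule_of_iSupIndep_of_iSup_eq_top
    (LieSubmodule.iSupIndep_toSubmodule.mpr <| LieModule.iSupIndep_genWeightSpace' ℂ 𝔥 𝔤)
    (LieSubmodule.iSup_toSubmodule_eq_top.mpr <| LieModule.iSup_genWeightSpace_eq_top' ℂ 𝔥 𝔤)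
  have h1 := LinearMap.trace_eq_sum_trace_restrict hds (f := LinearMap.id) (fun i x hx ↦ hx)
  have h2 : ∀ χ : LieModule.Weight ℂ 𝔥 𝔤, LinearMap.trace ℂ (rootSpace 𝔥 χ)
      ((LinearMap.id : 𝔤 →ₗ[ℂ] 𝔤).restrict (p := (rootSpace 𝔥 χ).toSubmodule)
        (q := (rootSpace 𝔥 χ).toSubmodule) (fun x hx ↦ hx)) =
      finrank ℂ (rootSpace 𝔥 χ) := by
    intro χ
    exact LinearMap.trace_id ℂ (rootSpace 𝔥 χ)
  have h3 : finrank ℂ 𝔤 = ∑ χ : LieModule.Weight ℂ 𝔥 𝔤, finrank ℂ (rootSpace 𝔥 χ) := by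
    have h4 : (finrank ℂ 𝔤 : ℂ) =
        ∑ χ : LieModule.Weight ℂ 𝔥 𝔤, (finrank ℂ (rootSpace 𝔥 χ) : ℂ) := by
      rw [← LinearMap.trace_id ℂ 𝔤, h1]
      exact Finset.sum_congr rfl fun χ _ ↦ h2 χ
    exact_mod_cast h4
  have h5 : finrank ℂ 𝔥 = Fintype.card b.support :=
    finrank_eq_card_basis b.toCoweightBasis
  have h6 : (0 : LieModule.Weight ℂ 𝔥 𝔤) ∉ 𝔥.root := by simp [LieModule.Weight.isZero_zero]
  have h7 : insert (0 : LieModule.Weight ℂ 𝔥 𝔤) 𝔥.root = Finset.univ := by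
    ext χ
    by_cases hχ : χ.IsZero
    · have : χ = 0 := by ext x; simp [hχ]
      simp [this]
    · have : χ.IsNonZero := hχ
      simpa using Or.inr this
  have h8 : rootSpace 𝔥 (0 : LieModule.Weight ℂ 𝔥 𝔤) = 𝔥.toLieSubmodule :=
    rootSpace_zero_eq ℂ 𝔤 𝔥
  have h9 : finrank ℂ (rootSpace 𝔥 (0 : LieModule.Weight ℂ 𝔥 𝔤)) = finrank ℂ 𝔥 := by
    rw [h8]; rfl
  rw [h3, ← h7, Finset.sum_insert h6, h9, h5]
  congr 1
  rw [Finset.sum_congr rfl fun χ hχ ↦ finrank_rootSpace_eq_one χ (by simpa using hχ),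
    Finset.sum_const, smul_eq_mul, mul_one]
  exact (Fintype.card_coe _).symm

end LieAlgebra

/-! ### Models of the positive roots and their transfer to a Lie algebra. -/

/-- An explicit description, by vectors `vec x` of a complex vector space, of the positive roots
of a root system with Cartan matrix `C`, such that the values at the positive roots of the half-sum
`ρ` of the positive roots and of its sum with the highest root `top` are related by the
parameters `-2`, `β` and `γ`. -/
structure PositiveRootModel {n : ℕ} (C : Matrix (Fin n) (Fin n) ℤ) (V κ : Type) [AddCommGroup V]
    [Module ℂ V] [Fintype κ] (β γ : ℂ) where
  /-- The positive roots. -/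
  vec : κ → V
  vec_injective : Function.Injective vec
  /-- The simple roots. -/
  simple : Fin n → κ
  /-- The simple coroots. -/
  coroot : Fin n → V →ₗ[ℂ] ℂ
  coroot_simple : ∀ i j, coroot j (vec (simple i)) = C i j
  exists_reflection : ∀ j x, x ≠ simple j →
    ∃ y, vec y = vec x - coroot j (vec x) • vec (simple j)
  induction_reflection : ∀ Q : κ → Prop, (∀ i, Q (simple i)) →
    (∀ j x y, x ≠ simple j → vec y = vec x - coroot j (vec x) • vec (simple j) → Q x → Q y) →
    ∀ x, Q x
  /-- The highest root. -/
  top : κ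
  eq_top : ∀ x, (∀ i y, vec y ≠ vec x + vec (simple i)) → x = top
  /-- Half the squares of the simple roots. -/
  halfSq : Fin n → ℂ
  halfSq_unique : ∀ g : Fin n → ℂ, (∀ i j, C i j * g j = C j i * g i) →
    ∃ k, ∀ i, g i = k * halfSq i
  /-- The scalar product with the half-sum of the positive roots. -/
  rhoForm : V →ₗ[ℂ] ℂ
  rhoForm_simple : ∀ i, rhoForm (vec (simple i)) = halfSq i
  rhoForm_ne_zero : ∀ x, rhoForm (vec x) ≠ 0
  rhoForm_top : rhoForm (vec top) = β + γ - 3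
  /-- The scalar product with the highest root. -/
  topForm : V →ₗ[ℂ] ℂ
  topForm_simple : ∀ i, topForm (vec (simple i)) = coroot i (vec top) * halfSq i
  topForm_top : topForm (vec top) = 2
  shift : Finset.univ.val.map (fun x ↦ topForm (vec x) + rhoForm (vec x)) + {1, β / 2, γ / 2} =
    Finset.univ.val.map (fun x ↦ rhoForm (vec x)) +
      {β + γ - 1, β / 2 + γ - 2, β + γ / 2 - 2}

section LieAlgebra

open LieAlgebra LieAlgebra.IsKilling

variable {𝔤 : Type*} [LieRing 𝔤] [LieAlgebra ℂ 𝔤] [FiniteDimensional ℂ 𝔤]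
  [LieAlgebra.IsSimple ℂ 𝔤] {𝔥 : LieSubalgebra ℂ 𝔤} [𝔥.IsCartanSubalgebra]

/-- If `θ` were negative, `-θ` and hence `-θ - θ` would be sums of simple roots, and maximality
would force `-θ = θ`. -/
theorem IsMaximalRoot.isPos {b : (rootSystem 𝔥).Base} {θ : 𝔥.root} (hθ : IsMaximalRoot b θ) :
    b.IsPos θ := by
  by_contra h
  let P := rootSystem 𝔥
  have h1 : b.IsPos (P.reflectionPerm θ θ) := (RootPairing.Base.IsPos.or_neg b θ).resolve_left h
  have h2 : P.root (P.reflectionPerm θ θ) = - P.root θ := by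
    rw [P.root_reflectionPerm, P.reflection_apply_self]
  have h3 : P.root (P.reflectionPerm θ θ) ∈ AddSubmonoid.closure (P.root '' b.support) := by
    refine h1.induction_on_add (p := fun i ↦ P.root i ∈ AddSubmonoid.closure
      (P.root '' b.support)) (fun i hi ↦ AddSubmonoid.subset_closure ⟨i, hi, rfl⟩)
      (fun i j k hk hi hj ↦ ?_)
    change P.root k = P.root i + P.root j at hk
    rw [hk]
    exact add_mem hi (AddSubmonoid.subset_closure ⟨j, hj, rfl⟩)
  have h4 : P.reflectionPerm θ θ = θ := by
    refine hθ _ ?_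
    change P.root (P.reflectionPerm θ θ) - P.root θ ∈ AddSubmonoid.closure (P.root '' b.support)
    rw [sub_eq_add_neg, ← h2]
    exact add_mem h3 h3
  rw [h4] at h1
  exact h h1

theorem IsMaximalRoot.add_ne {b : (rootSystem 𝔥).Base} {θ : 𝔥.root} (hθ : IsMaximalRoot b θ)
    {j : 𝔥.root} (hj : j ∈ b.support) (i : 𝔥.root) :
    (rootSystem 𝔥).root i ≠ (rootSystem 𝔥).root θ + (rootSystem 𝔥).root j := by
  intro h
  have h1 : i = θ := hθ i (by
    rw [h, add_sub_cancel_left]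
    exact AddSubmonoid.subset_closure ⟨j, hj, rfl⟩)
  rw [h1, left_eq_add] at h
  exact (rootSystem 𝔥).ne_zero j h

variable {n : ℕ} {C : Matrix (Fin n) (Fin n) ℤ} {V κ : Type} [AddCommGroup V]
  [Module ℂ V] [Fintype κ] {β γ : ℂ}

/-- The Cartan matrix determines the positive roots through simple reflections, and the invariant
form up to a scalar. So the linear map matching simple roots with those of the model matches
everything else. -/
theorem PositiveRootModel.exists_labelling (m : PositiveRootModel C V κ β γ)
    {b : (rootSystem 𝔥).Base} (e : b.support ≃ Fin n)
    (he : ∀ i j, b.cartanMatrix i j = C (e i) (e j)) {θ : 𝔥.root} (hθ : IsMaximalRoot b θ) :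
    ∃ (k : ℂ) (r : κ → 𝔥.root), k ≠ 0 ∧ Function.Injective r ∧
      (∀ i, b.IsPos i ↔ ∃ x, r x = i) ∧ r m.top = θ ∧
      (∀ x, canonicalForm ((rootSystem 𝔥).root θ) ((rootSystem 𝔥).root (r x)) =
        k * m.topForm (m.vec x)) ∧
      (∀ x, canonicalForm (rho b) ((rootSystem 𝔥).root (r x)) = k * m.rhoForm (m.vec x)) := by
  let P := rootSystem 𝔥
  let B : Basis b.support ℂ (Dual ℂ 𝔥) := b.toWeightBasis
  have hB : ∀ i : b.support, B i = P.root i := b.toWeightBasis_apply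
  let T : Dual ℂ 𝔥 →ₗ[ℂ] V := B.constr ℂ fun i ↦ m.vec (m.simple (e i))
  have hT : ∀ i : b.support, T (P.root i) = m.vec (m.simple (e i)) := fun i ↦ by
    rw [← hB, B.constr_basis]
  have hcartan : ∀ i j : b.support, (b.cartanMatrix i j : ℂ) = P.pairing i j := fun i j ↦
    (eq_intCast (algebraMap ℤ ℂ) _).symm.trans (b.algebraMap_cartanMatrixIn_apply ℤ i j)
  have hcoroot : ∀ (j : b.support) (φ : Dual ℂ 𝔥), m.coroot (e j) (T φ) = φ (P.coroot j) := by
    intro j φ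
    have h : (m.coroot (e j)).comp T = Dual.eval ℂ 𝔥 (P.coroot j) := by
      refine B.ext fun i ↦ ?_
      rw [LinearMap.comp_apply, hB, hT, m.coroot_simple, ← he, Dual.eval_apply]
      exact (hcartan i j).trans (P.root_coroot_eq_pairing i j).symm
    exact LinearMap.congr_fun h φ
  -- `T` respects the simple coroots, and these span `𝔥`.
  have hTinj : Function.Injective T := by
    rw [← LinearMap.ker_eq_bot, LinearMap.ker_eq_bot']
    intro φ hφ
    refine b.toCoweightBasis.ext fun j ↦ ?_
    rw [b.toCoweightBasis_apply, LinearMap.zero_apply]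
    have := hcoroot j φ
    rw [hφ, map_zero] at this
    exact this.symm
  have hTrefl : ∀ (j : b.support) (i : 𝔥.root), T (P.root (P.reflectionPerm j i)) =
      T (P.root i) - m.coroot (e j) (T (P.root i)) • m.vec (m.simple (e j)) := by
    intro j i
    rw [hcoroot, P.root_reflectionPerm, P.reflection_apply, map_sub, map_smul, hT]
    rfl
  have hposvec : ∀ x, ∃ i, b.IsPos i ∧ T (P.root i) = m.vec x := by
    refine m.induction_reflection _ (fun i ↦ ?_) ?_
    · refine ⟨e.symm i, b.isPos_of_mem_support (e.symm i).2, ?_⟩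
      rw [hT, e.apply_symm_apply]
    · rintro j x y hx hy ⟨i, hi, hix⟩
      refine ⟨P.reflectionPerm (e.symm j) i, hi.reflectionPerm (e.symm j).2 ?_, ?_⟩
      · rintro rfl
        rw [hT, e.apply_symm_apply] at hix
        exact hx (m.vec_injective hix.symm)
      · rw [hTrefl, e.apply_symm_apply, hix, hy]
  choose r hrpos hr using hposvec
  have hrinj : Function.Injective r := fun x y h ↦ m.vec_injective (by rw [← hr, ← hr, h])
  -- The sign is allowed because the statement must survive each simple reflection: `s_j` negates
  -- `α_j` and permutes the other vectors of the model.
  have hpm : ∀ i, b.IsPos i → (∃ x, T (P.root i) = m.vec x) ∨ ∃ x, T (P.root i) = - m.vec x := by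
    intro i hi
    refine hi.induction_on_reflect (p := fun i ↦
      (∃ x, T (P.root i) = m.vec x) ∨ ∃ x, T (P.root i) = - m.vec x) (fun i hi ↦ ?_) ?_
    · exact Or.inl ⟨_, hT ⟨i, hi⟩⟩
    · intro i j hi hj
      have h1 := hTrefl ⟨j, hj⟩ i
      have h2 : m.coroot (e ⟨j, hj⟩) (m.vec (m.simple (e ⟨j, hj⟩))) = 2 := by
        rw [← hT, hcoroot]
        exact (P.root_coroot_eq_pairing j j).trans (P.pairing_same j)
      change (∃ x, T (P.root (P.reflectionPerm j i)) = m.vec x) ∨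
        ∃ x, T (P.root (P.reflectionPerm j i)) = - m.vec x
      rw [h1]
      rcases hi with ⟨x, hx⟩ | ⟨x, hx⟩ <;> rw [hx] <;> by_cases hxj : x = m.simple (e ⟨j, hj⟩)
      · refine Or.inr ⟨x, ?_⟩
        rw [hxj, h2]; module
      · obtain ⟨y, hy⟩ := m.exists_reflection _ _ hxj
        exact Or.inl ⟨y, hy.symm⟩
      · refine Or.inl ⟨x, ?_⟩
        rw [hxj, map_neg, h2]; module
      · obtain ⟨y, hy⟩ := m.exists_reflection _ _ hxj
        refine Or.inr ⟨y, ?_⟩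
        rw [hy, map_neg]; module
  have hrsurj : ∀ i, b.IsPos i ↔ ∃ x, r x = i := by
    intro i
    refine ⟨fun hi ↦ ?_, fun ⟨x, hx⟩ ↦ hx ▸ hrpos x⟩
    rcases hpm i hi with ⟨x, hx⟩ | ⟨x, hx⟩
    · exact ⟨x, P.root.injective (hTinj (by rw [hr, hx]))⟩
    · exfalso
      -- A minus sign would make `-i` the positive root labelled by `x`.
      have h1 : P.root (r x) = P.root (P.reflectionPerm i i) := by
        refine hTinj ?_
        rw [hr, P.root_reflectionPerm, P.reflection_apply_self, map_neg, hx, neg_neg]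
      have h2 := hrpos x
      rw [P.root.injective h1] at h2
      exact (RootPairing.Base.IsPos.neg_iff_not b i).mp h2 hi
  have hrtop : r m.top = θ := by
    obtain ⟨x, hx⟩ := (hrsurj θ).mp hθ.isPos
    have h1 : x = m.top := by
      refine m.eq_top x fun i y hy ↦ hθ.add_ne (e.symm i).2 (r y) ?_
      refine hTinj ?_
      change T (P.root (r y)) = T (P.root θ + P.root (e.symm i))
      rw [hr, map_add, hT, ← hx, hr, hy, e.apply_symm_apply]
    rw [← h1, hx]
  have hTθ : T (P.root θ) = m.vec m.top := by rw [← hrtop, hr]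
  let q : 𝔥.root → ℂ := fun i ↦ canonicalForm (P.root i) (P.root i) / 2
  -- Half the squares of the simple roots symmetrise the Cartan matrix, since `C i j * q j` is the
  -- scalar product of the two simple roots. Such a symmetriser is unique up to a scalar.
  obtain ⟨k, hk⟩ := m.halfSq_unique (fun i ↦ q (e.symm i)) (by
    intro i j
    have key : ∀ i j : b.support, (b.cartanMatrix i j : ℂ) * q j =
        canonicalForm (P.root i) (P.root j) := by
      intro i j
      have h1 : (b.cartanMatrix i j : ℂ) = P.root i (P.coroot j) := by
        exact (hcartan i j).trans (P.root_coroot_eq_pairing i j).symm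
      have h2 : P.root i (P.coroot j) * canonicalForm (P.root j) (P.root j) =
        2 * canonicalForm (P.root i) (P.root j) := apply_coroot_mul_canonicalForm (P.root i) j
      simp only [q]
      rw [h1]
      linear_combination h2 / 2
    have h1 := key (e.symm i) (e.symm j)
    have h2 := key (e.symm j) (e.symm i)
    simp only [he, e.apply_symm_apply] at h1 h2
    rw [h1, h2, canonicalForm_comm])
  have hq : ∀ i : b.support, q i = k * m.halfSq (e i) := by
    intro i
    simpa using hk (e i)
  -- A functional `⟨φ, ·⟩` is determined by its values at the simple roots, which are the values of
  -- `φ` at the simple coroots times half the squares.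
  have hform : ∀ (φ : Dual ℂ 𝔥) (f : V →ₗ[ℂ] ℂ),
      (∀ i : b.support, f (m.vec (m.simple (e i))) = φ (P.coroot i) * m.halfSq (e i)) →
      ∀ ψ, canonicalForm φ ψ = k * f (T ψ) := by
    intro φ f hf ψ
    have h1 : (canonicalForm φ : Dual ℂ 𝔥 → ℂ) =
        (Dual.eval ℂ 𝔥 ((cartanEquivDual 𝔥).symm φ) : Dual ℂ 𝔥 → ℂ) := by
      ext ψ
      rw [canonicalForm_comm, canonicalForm_eq_apply]; rfl
    have h2 : Dual.eval ℂ 𝔥 ((cartanEquivDual 𝔥).symm φ) = k • f.comp T := by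
      refine B.ext fun i ↦ ?_
      rw [← h1, hB, LinearMap.smul_apply, LinearMap.comp_apply, hT, hf, smul_eq_mul]
      have h3 : φ (P.coroot i) * canonicalForm (P.root i) (P.root i) =
        2 * canonicalForm φ (P.root i) := apply_coroot_mul_canonicalForm φ i
      have h4 := hq i
      simp only [q] at h4
      linear_combination (-1 / 2) * h3 + φ (P.coroot i) * h4
    rw [h1, h2]; rfl
  have hθform : ∀ ψ, canonicalForm (P.root θ) ψ = k * m.topForm (T ψ) :=
    hform _ _ fun i ↦ by rw [m.topForm_simple, ← hTθ, hcoroot]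
  have hρform : ∀ ψ, canonicalForm (rho b) ψ = k * m.rhoForm (T ψ) :=
    hform _ _ fun i ↦ by
      have : rho b (P.coroot i) = 1 := rho_coroot b i.2
      rw [m.rhoForm_simple, this, one_mul]
  refine ⟨k, r, ?_, hrinj, hrsurj, hrtop, fun x ↦ ?_, fun x ↦ ?_⟩
  · rintro rfl
    refine canonicalForm_root_ne_zero θ ?_
    change canonicalForm (P.root θ) (P.root θ) = 0
    rw [hθform, zero_mul]
  · rw [← hr]; exact hθform _
  · rw [← hr]; exact hρform _

end LieAlgebra

/-! ### Logarithmic derivatives and limits of products of linear fractions. -/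

section Analysis

open Filter Topology Bornology

theorem tendsto_sub_mul_div_sub_mul_cobounded (A a B : ℂ) {b : ℂ} (hb : b ≠ 0) :
    Tendsto (fun z ↦ (A - a * z) / (B - b * z)) (cobounded ℂ) (𝓝 (a / b)) := by
  have h0 : Tendsto (fun z : ℂ ↦ z⁻¹) (cobounded ℂ) (𝓝 0) := tendsto_inv₀_cobounded
  have h1 : Tendsto (fun z : ℂ ↦ (A * z⁻¹ - a) / (B * z⁻¹ - b)) (cobounded ℂ)
      (𝓝 ((A * 0 - a) / (B * 0 - b))) :=
    ((h0.const_mul A).sub_const a).div ((h0.const_mul B).sub_const b) (by simpa using hb)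
  have h2 : (A * 0 - a) / (B * 0 - b) = a / b := by
    rw [mul_zero, mul_zero, zero_sub, zero_sub, neg_div_neg_eq]
  rw [h2] at h1
  refine h1.congr' ?_
  filter_upwards [eventually_ne_cobounded (0 : ℂ)] with z hz
  rw [← mul_div_mul_right _ _ hz]
  congr 1 <;> field_simp

/-- Each factor contributes `a z/(1 - a z) - b z/(1 - b z)` to `-z` times the logarithmic
derivative, a difference of two geometric series. Their constant terms cancel, in agreement with `a
^ 0 - b ^ 0 = 0`. -/
theorem eventually_hasSum_log_prod_div (ι : Type*) [Fintype ι] (a b : ι → ℂ) :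
    ∀ᶠ z in 𝓝 (0 : ℂ),
      DifferentiableAt ℂ (fun w ↦ Complex.log (∏ i, (1 - a i * w) / (1 - b i * w))) z ∧
      HasSum (fun k : ℕ ↦ 2 * (∑ i, (a i ^ k - b i ^ k)) * z ^ k)
        (-2 * z * deriv (fun w ↦ Complex.log (∏ i, (1 - a i * w) / (1 - b i * w))) z) := by
  have hsmall : ∀ c : ℂ, ∀ᶠ z in 𝓝 (0 : ℂ), ‖c * z‖ < 1 := fun c ↦ by
    have : Tendsto (fun z : ℂ ↦ ‖c * z‖) (𝓝 0) (𝓝 ‖c * 0‖) := by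
      exact Continuous.tendsto (by fun_prop) 0
    rw [mul_zero, norm_zero] at this
    exact this.eventually (gt_mem_nhds one_pos)
  have hne : ∀ {c z : ℂ}, ‖c * z‖ < 1 → 1 - c * z ≠ 0 := fun {c z} h h' ↦ by
    rw [← sub_eq_zero.mp h', norm_one] at h
    exact lt_irrefl _ h
  have hdiff : ∀ {z : ℂ}, (∀ i, ‖b i * z‖ < 1) → ∀ i,
      DifferentiableAt ℂ (fun w ↦ (1 - a i * w) / (1 - b i * w)) z := fun {z} h i ↦ by
    have := hne (h i)
    fun_prop (disch := assumption)
  have hdiffU : ∀ {z : ℂ}, (∀ i, ‖b i * z‖ < 1) →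
      DifferentiableAt ℂ (fun w ↦ ∏ i, (1 - a i * w) / (1 - b i * w)) z := fun {z} h ↦ by
    have := DifferentiableAt.fun_finsetProd (u := Finset.univ) fun i _ ↦ hdiff h i
    exact this
  -- The product equals `1` at the origin, so near it the principal logarithm is holomorphic.
  have hslit : ∀ᶠ z in 𝓝 (0 : ℂ), (∏ i, (1 - a i * z) / (1 - b i * z)) ∈ Complex.slitPlane := by
    have h0 : DifferentiableAt ℂ (fun w ↦ ∏ i, (1 - a i * w) / (1 - b i * w)) 0 :=
      hdiffU fun i ↦ by simp
    refine h0.continuousAt.eventually (Complex.isOpen_slitPlane.mem_nhds ?_)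
    simp
  filter_upwards [eventually_all.mpr fun i ↦ hsmall (a i), eventually_all.mpr fun i ↦ hsmall (b i),
    hslit] with z ha hb hz
  refine ⟨(hdiffU hb).clog hz, ?_⟩
  have hderiv : deriv (fun w ↦ Complex.log (∏ i, (1 - a i * w) / (1 - b i * w))) z =
      ∑ i, (-a i / (1 - a i * z) - -b i / (1 - b i * z)) := by
    rw [((hdiffU hb).hasDerivAt.clog hz).deriv]
    have hlin : ∀ c : ℂ, logDeriv (fun w ↦ 1 - c * w) z = -c / (1 - c * z) := fun c ↦ by
      rw [logDeriv_apply]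
      congr 1
      have : HasDerivAt (fun w ↦ 1 - c * w) (-(c * 1)) z :=
        ((hasDerivAt_id z).const_mul c).const_sub 1
      rw [this.deriv, mul_one]
    rw [← logDeriv_apply, logDeriv_prod]
    · refine Finset.sum_congr rfl fun i _ ↦ ?_
      rw [logDeriv_div z (hne (ha i)) (hne (hb i)) (by fun_prop) (by fun_prop), hlin, hlin]
    · exact fun i _ ↦ div_ne_zero (hne (ha i)) (hne (hb i))
    · exact fun i _ ↦ hdiff hb i
  have hgeom : ∀ i, HasSum (fun k : ℕ ↦ (a i * z) ^ k - (b i * z) ^ k)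
      ((1 - a i * z)⁻¹ - (1 - b i * z)⁻¹) := fun i ↦
    (hasSum_geometric_of_norm_lt_one (ha i)).sub (hasSum_geometric_of_norm_lt_one (hb i))
  have hsum := (hasSum_sum (s := Finset.univ) fun i _ ↦ hgeom i).mul_left 2
  convert! hsum using 1
  · ext k
    rw [mul_assoc, Finset.sum_mul]
    simp only [mul_pow, sub_mul]
  · rw [hderiv, mul_assoc, neg_mul, ← mul_neg, Finset.mul_sum, ← Finset.sum_neg_distrib]
    congr 1
    refine Finset.sum_congr rfl fun i _ ↦ ?_
    have h1 := mul_inv_cancel₀ (hne (ha i))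
    have h2 := mul_inv_cancel₀ (hne (hb i))
    simp only [div_eq_mul_inv]
    linear_combination h2 - h1

end Analysis

/-! ### The universal formulas deduced from a model. -/

section LieAlgebra

open LieAlgebra LieAlgebra.IsKilling Filter Topology Bornology

variable {𝔤 : Type*} [LieRing 𝔤] [LieAlgebra ℂ 𝔤] [FiniteDimensional ℂ 𝔤]
  [LieAlgebra.IsSimple ℂ 𝔤] {𝔥 : LieSubalgebra ℂ 𝔤} [𝔥.IsCartanSubalgebra]

open Classical in
theorem sum_root_eq_two_mul_sum_pos (b : (rootSystem 𝔥).Base) (g : 𝔥.root → ℂ)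
    (hg : ∀ i, g ((rootSystem 𝔥).reflectionPerm i i) = g i) :
    ∑ i, g i = 2 * ∑ i with b.IsPos i, g i := by
  let P := rootSystem 𝔥
  rw [← Finset.sum_filter_add_sum_filter_not Finset.univ (fun i ↦ b.IsPos i), two_mul]
  congr 1
  have hinv : ∀ i, P.reflectionPerm (P.reflectionPerm i i) (P.reflectionPerm i i) = i := fun i ↦ by
    apply P.root.injective
    rw [P.root_reflectionPerm, P.reflection_apply_self, P.root_reflectionPerm,
      P.reflection_apply_self, neg_neg]
  have hneg : ∀ i, b.IsPos (P.reflectionPerm i i) ↔ ¬ b.IsPos i :=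
    RootPairing.Base.IsPos.neg_iff_not b
  refine Finset.sum_nbij' (fun i ↦ P.reflectionPerm i i) (fun i ↦ P.reflectionPerm i i)
    (fun i hi ↦ ?_) (fun i hi ↦ ?_) (fun i _ ↦ hinv i) (fun i _ ↦ hinv i) (fun i _ ↦ (hg i).symm)
  · simpa [hneg] using hi
  · simpa [hneg] using hi

variable {n : ℕ} {C : Matrix (Fin n) (Fin n) ℤ} {V κ : Type} [AddCommGroup V]
  [Module ℂ V] [Fintype κ] {β γ : ℂ}

theorem canonicalForm_add_left (φ ψ χ : Dual ℂ 𝔥) :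
    canonicalForm (φ + ψ) χ = canonicalForm φ χ + canonicalForm ψ χ := by
  simp only [canonicalForm_eq_apply, LinearMap.add_apply]

theorem canonicalForm_neg_right (φ ψ : Dual ℂ 𝔥) :
    canonicalForm φ (-ψ) = - canonicalForm φ ψ := by
  simp only [canonicalForm_eq_apply, map_neg]

/-- This is `shift` tested against `f`; it collapses a sum over positive roots to three terms. -/
theorem PositiveRootModel.sum_shift (m : PositiveRootModel C V κ β γ) (f : ℂ → ℂ) :
    ∑ x, (f (m.topForm (m.vec x) + m.rhoForm (m.vec x)) - f (m.rhoForm (m.vec x))) =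
      ∑ i, (f (![β + γ - 1, β / 2 + γ - 2, β + γ / 2 - 2] i) - f (![1, β / 2, γ / 2] i)) := by
  have h := congrArg (fun s : Multiset ℂ ↦ (s.map f).sum) m.shift
  simp only [Multiset.map_add, Multiset.sum_add, Multiset.map_map, Function.comp_def,
    Multiset.insert_eq_cons, Multiset.map_cons, Multiset.sum_cons, Multiset.map_singleton,
    Multiset.sum_singleton] at h
  change ∑ x, f (m.topForm (m.vec x) + m.rhoForm (m.vec x)) + _ =
    ∑ x, f (m.rhoForm (m.vec x)) + _ at h
  rw [Finset.sum_sub_distrib]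
  simp only [Fin.sum_univ_three, Matrix.cons_val]
  linear_combination h

theorem PositiveRootModel.prod_shift (m : PositiveRootModel C V κ β γ) :
    (∏ x, (m.topForm (m.vec x) + m.rhoForm (m.vec x))) * (β * γ / 4) =
      (∏ x, m.rhoForm (m.vec x)) *
        ((β + γ - 1) * (β / 2 + γ - 2) * (β + γ / 2 - 2)) := by
  have h := congrArg Multiset.prod m.shift
  simp only [Multiset.prod_add, Multiset.insert_eq_cons, Multiset.prod_cons,
    Multiset.prod_singleton] at h
  change (∏ x, (m.topForm (m.vec x) + m.rhoForm (m.vec x))) * _ =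
    (∏ x, m.rhoForm (m.vec x)) * _ at h
  linear_combination h

/-- Apart from the model, the type enters only through `hdim`, the count of roots, and through the
nonvanishing of `t`, `β` and `γ`. -/
theorem PositiveRootModel.universal (m : PositiveRootModel C V κ β γ)
    {b : (rootSystem 𝔥).Base} (e : b.support ≃ Fin n)
    (he : ∀ i j, b.cartanMatrix i j = C (e i) (e j)) {θ : 𝔥.root} (hθ : IsMaximalRoot b θ)
    {lam : Dual ℂ 𝔥} (hlam : lam = (rootSystem 𝔥).root θ) {t : ℂ} (ht : t = -2 + β + γ)
    (ht0 : t ≠ 0) (hβ : β ≠ 0) (hγ : γ ≠ 0)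
    (hdim : (n + 2 * Fintype.card κ : ℂ) =
      ((-2 - 2 * t) * (β - 2 * t) * (γ - 2 * t)) / (-2 * β * γ)) :
    (∀ᶠ z in 𝓝 (0 : ℂ),
      DifferentiableAt ℂ (fun w => Complex.log (universalRatio (-2) β γ w)) z ∧
      HasSum (fun k : ℕ => casimir b lam k * z ^ k)
        (-2 * z * deriv (fun w => Complex.log (universalRatio (-2) β γ w)) z)) ∧
    casimir b lam 1 = 1 ∧
    casimir b lam 2 =
      (2 * t ^ 3 + 3 * t * ((-2) ^ 2 + β ^ 2 + γ ^ 2) - ((-2) ^ 3 + β ^ 3 + γ ^ 3)) /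
        (16 * t ^ 3) ∧
    Tendsto (rootRatio b (minimalForm θ) lam) (cobounded ℂ) (𝓝 ((finrank ℂ 𝔤 : ℂ) ^ 2)) ∧
    Tendsto (universalRatio (-2) β γ) (cobounded ℂ) (𝓝 ((finrank ℂ 𝔤 : ℂ) ^ 2)) ∧
    (finrank ℂ 𝔤 : ℂ) = ((-2 - 2 * t) * (β - 2 * t) * (γ - 2 * t)) / (-2 * β * γ) := by
  classical
  obtain ⟨k₀, r, hk₀, hrinj, hrpos, hrtop, hrθ, hrρ⟩ := m.exists_labelling e he hθ
  let P := rootSystem 𝔥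
  have hpos : (Finset.univ.filter fun i ↦ b.IsPos i) = Finset.univ.image r := by
    ext i; simp [hrpos]
  have hsum : ∀ g : 𝔥.root → ℂ, (∀ i, g (P.reflectionPerm i i) = g i) →
      ∑ i, g i = 2 * ∑ x, g (r x) := fun g hg ↦ by
    rw [sum_root_eq_two_mul_sum_pos b g hg, hpos, Finset.sum_image hrinj.injOn]
  have hlamρ : ∀ x, canonicalForm (lam + rho b) (P.root (r x)) =
      k₀ * (m.topForm (m.vec x) + m.rhoForm (m.vec x)) := fun x ↦ by
    rw [canonicalForm_add_left, hlam, mul_add]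
    exact congrArg₂ _ (hrθ x) (hrρ x)
  have hrρ' : ∀ x, canonicalForm (rho b) (P.root (r x)) = k₀ * m.rhoForm (m.vec x) := hrρ
  -- Even powers do not distinguish `μ` from `-μ`, whence the factor `2` and the restriction to
  -- positive roots.
  have hcas : ∀ k, casimir b lam k = 2 * ∑ i : Fin 3,
      ((k₀ * (![β + γ - 1, β / 2 + γ - 2, β + γ / 2 - 2] i)) ^ (2 * k) -
        (k₀ * (![1, β / 2, γ / 2] i)) ^ (2 * k)) := fun k ↦ by
    have h1 : casimir b lam k = ∑ i : 𝔥.root, (canonicalForm (lam + rho b) (P.root i) ^ (2 * k) -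
      canonicalForm (rho b) (P.root i) ^ (2 * k)) := rfl
    rw [h1, hsum, ← m.sum_shift fun y ↦ (k₀ * y) ^ (2 * k)]
    · simp only [hlamρ, hrρ']
    · intro i
      simp only [P.root_reflectionPerm, P.reflection_apply_self, canonicalForm_neg_right,
        (even_two_mul k).neg_pow]
  have hθθ : canonicalForm lam lam = k₀ * 2 := by
    have := hrθ m.top
    rw [hrtop, m.topForm_top] at this
    rw [hlam, this]
  have hρθ : canonicalForm (rho b) lam = k₀ * (β + γ - 3) := by
    have := hrρ m.top
    rw [hrtop, m.rhoForm_top] at this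
    rw [hlam, this]
  -- The number `⟨λ+ρ, λ+ρ⟩ - ⟨ρ, ρ⟩` is `⟨λ, λ⟩ + 2⟨ρ, λ⟩ = 2tk₀`, and by `canonicalForm_eq_sum` it
  -- is also the second Casimir sum, `4t²k₀²`.
  have hk : 2 * t * k₀ = 1 := by
    have h1 := canonicalForm_eq_sum (lam + rho b) (lam + rho b)
    have h2 := canonicalForm_eq_sum (rho b) (rho b)
    have h3 : canonicalForm (lam + rho b) (lam + rho b) - canonicalForm (rho b) (rho b) =
        casimir b lam 1 := by
      rw [h1, h2, ← Finset.sum_sub_distrib, casimir]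
      refine Finset.sum_congr rfl fun i _ ↦ by ring
    have h4 : canonicalForm (lam + rho b) (lam + rho b) - canonicalForm (rho b) (rho b) =
        canonicalForm lam lam + 2 * canonicalForm (rho b) lam := by
      rw [canonicalForm_add_left, canonicalForm_comm lam, canonicalForm_comm (rho b) (lam + rho b),
        canonicalForm_add_left, canonicalForm_add_left, canonicalForm_comm lam (rho b)]
      ring
    rw [h4, hcas, hθθ, hρθ] at h3
    simp only [Fin.sum_univ_three, Matrix.cons_val] at h3
    have h5 : (2 * k₀ * t) * (2 * t * k₀ - 1) = 0 := by
      rw [ht]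
      linear_combination -h3
    have h6 : 2 * k₀ * t ≠ 0 := mul_ne_zero (mul_ne_zero two_ne_zero hk₀) ht0
    linear_combination (mul_eq_zero.mp h5).resolve_left h6
  -- With `k₀ = 1/(2t)`, the square of `k₀ (2t-α)/2` is `(2t-α)²/(16t²)`, and likewise for the other
  -- factors.
  have hU : universalRatio (-2) β γ = fun z ↦ ∏ i : Fin 3,
      (1 - (k₀ * (![β + γ - 1, β / 2 + γ - 2, β + γ / 2 - 2] i)) ^ 2 * z) /
        (1 - (k₀ * (![1, β / 2, γ / 2] i)) ^ 2 * z) := by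
    ext z
    have h1 : ∀ a c : ℂ, (16 * t ^ 2 - (2 * a) ^ 2 * z) / (16 * t ^ 2 - (2 * c) ^ 2 * z) =
        (1 - (k₀ * a) ^ 2 * z) / (1 - (k₀ * c) ^ 2 * z) := fun a c ↦ by
      have h2 : (16 * t ^ 2 : ℂ) ≠ 0 := mul_ne_zero (by norm_num) (pow_ne_zero 2 ht0)
      rw [← mul_div_mul_left (1 - (k₀ * a) ^ 2 * z) (1 - (k₀ * c) ^ 2 * z) h2]
      congr 1
      · linear_combination 4 * a ^ 2 * z * (2 * t * k₀ + 1) * hk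
      · linear_combination 4 * c ^ 2 * z * (2 * t * k₀ + 1) * hk
    simp only [Fin.prod_univ_three, Matrix.cons_val]
    rw [← h1, ← h1, ← h1, div_mul_div_comm, div_mul_div_comm, universalRatio, ht]
    congr 1 <;> ring
  have hγt : γ = t + 2 - β := by linear_combination -ht
  have hfin : (finrank ℂ 𝔤 : ℂ) =
      ((-2 - 2 * t) * (β - 2 * t) * (γ - 2 * t)) / (-2 * β * γ) := by
    rw [← hdim, finrank_eq_card_add_card b, Fintype.card_congr e, Fintype.card_fin]
    have h1 := hsum (fun _ ↦ 1) fun _ ↦ rfl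
    simp only [Finset.sum_const, Finset.card_univ, nsmul_eq_mul, mul_one] at h1
    push_cast
    rw [h1]
  have hfin' : (finrank ℂ 𝔤 : ℂ) =
      ((β + γ - 1) * (β / 2 + γ - 2) * (β + γ / 2 - 2)) / (β * γ / 4) := by
    rw [hfin, ht]
    field_simp
    ring
  refine ⟨?_, ?_, ?_, ?_, ?_, hfin⟩
  · rw [hU]
    filter_upwards [eventually_hasSum_log_prod_div (Fin 3)
      (fun i ↦ (k₀ * (![β + γ - 1, β / 2 + γ - 2, β + γ / 2 - 2] i)) ^ 2)
      (fun i ↦ (k₀ * (![1, β / 2, γ / 2] i)) ^ 2)] with z hz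
    refine ⟨hz.1, ?_⟩
    have := hz.2
    simp only [← pow_mul, ← hcas] at this
    exact this
  · rw [hcas]
    simp only [Fin.sum_univ_three, Matrix.cons_val, hγt]
    linear_combination (2 * t * k₀ + 1) * hk
  · rw [hcas]
    simp only [Fin.sum_univ_three, Matrix.cons_val, hγt]
    rw [eq_div_iff (mul_ne_zero (by norm_num) (pow_ne_zero 3 ht0))]
    have h1 : 16 * t ^ 4 * k₀ ^ 4 = 1 := by
      rw [← one_pow (M := ℂ) 4, ← hk]; ring
    linear_combination (2 * t ^ 3 + 3 * t * ((-2) ^ 2 + β ^ 2 + (t + 2 - β) ^ 2) -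
      ((-2) ^ 3 + β ^ 3 + (t + 2 - β) ^ 3)) * h1
  · have hmin : ∀ φ ψ, minimalForm θ φ ψ = k₀⁻¹ * canonicalForm φ ψ := fun φ ψ ↦ by
      rw [minimalForm, ← hlam, hθθ]
      field_simp
    have h1 : rootRatio b (minimalForm θ) lam = fun z ↦ ∏ x,
        (1 - (m.topForm (m.vec x) + m.rhoForm (m.vec x)) ^ 2 * z) /
          (1 - (m.rhoForm (m.vec x)) ^ 2 * z) := by
      ext z
      rw [rootRatio]
      change ∏ i with b.IsPos i, (1 - minimalForm θ (lam + rho b) (P.root i) ^ 2 * z) /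
        (1 - minimalForm θ (rho b) (P.root i) ^ 2 * z) = _
      rw [hpos, Finset.prod_image hrinj.injOn]
      refine Finset.prod_congr rfl fun x _ ↦ ?_
      rw [hmin, hmin, hlamρ, hrρ', inv_mul_cancel_left₀ hk₀, inv_mul_cancel_left₀ hk₀]
    -- `prod_shift` replaces the product over the positive roots by the three-term quotient already
    -- identified with the dimension.
    have h2 : ((finrank ℂ 𝔤 : ℂ)) ^ 2 = ∏ x,
        ((m.topForm (m.vec x) + m.rhoForm (m.vec x)) ^ 2 / (m.rhoForm (m.vec x)) ^ 2) := by
      have h3 := m.prod_shift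
      have h4 : ∏ x, m.rhoForm (m.vec x) ≠ 0 :=
        Finset.prod_ne_zero_iff.mpr fun x _ ↦ m.rhoForm_ne_zero x
      simp only [← div_pow]
      rw [Finset.prod_pow, Finset.prod_div_distrib, hfin']
      congr 1
      rw [div_eq_div_iff (div_ne_zero (mul_ne_zero hβ hγ) (by norm_num)) h4]
      linear_combination -h3
    rw [h1, h2]
    exact tendsto_finsetProd _ fun x _ ↦
      tendsto_sub_mul_div_sub_mul_cobounded _ _ _ (pow_ne_zero 2 (m.rhoForm_ne_zero x))
  · have h2 : ((finrank ℂ 𝔤 : ℂ)) ^ 2 = ∏ i : Fin 3,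
        ((k₀ * (![β + γ - 1, β / 2 + γ - 2, β + γ / 2 - 2] i)) ^ 2 /
          (k₀ * (![1, β / 2, γ / 2] i)) ^ 2) := by
      simp only [Fin.prod_univ_three, Matrix.cons_val]
      rw [hfin']
      field_simp
      ring
    rw [hU, h2]
    refine tendsto_finsetProd _ fun i _ ↦ tendsto_sub_mul_div_sub_mul_cobounded _ _ _ ?_
    refine pow_ne_zero 2 (mul_ne_zero hk₀ ?_)
    fin_cases i <;> simp [hβ, hγ]

end LieAlgebra

/-! ### Symmetrisers and coded tables of positive roots. -/

/-- The Dynkin diagram is a tree: `parent` is the next node on the way to `root`, and along each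
edge the symmetry condition fixes the ratio of the two values. Induction on the distance to `root`
does the rest. -/
theorem exists_eq_mul_of_parent {n : ℕ} {C : Matrix (Fin n) (Fin n) ℤ} (d : Fin n → ℤ)
    (parent : Fin n → Fin n) (root : Fin n) (hd : d root ≠ 0)
    (hiter : ∀ i, parent^[n] i = root)
    (hparent : ∀ i, i ≠ root → C (parent i) i ≠ 0 ∧
      C i (parent i) * d (parent i) = C (parent i) i * d i)
    (g : Fin n → ℂ) (hg : ∀ i j, C i j * g j = C j i * g i) :
    ∃ k, ∀ i, g i = k * (d i : ℂ) := by
  have hd' : (d root : ℂ) ≠ 0 := by exact_mod_cast hd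
  have key : ∀ m i, parent^[m] i = root → g i = g root / d root * d i := by
    intro m
    induction m with
    | zero =>
      intro i hi
      obtain rfl : i = root := hi
      field_simp
    | succ m ih =>
      intro i hm
      by_cases hi : i = root
      · subst hi
        field_simp
      · obtain ⟨h1, h2⟩ := hparent i hi
        have h3 := ih (parent i) hm
        have h4 := hg i (parent i)
        have h5 : (C (parent i) i : ℂ) ≠ 0 := by exact_mod_cast h1
        have h6 : (C i (parent i) : ℂ) * d (parent i) = C (parent i) i * d i := by exact_mod_cast h2
        refine mul_left_cancel₀ h5 ?_
        rw [← h4, h3]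
        linear_combination (g root / d root) * h6
  exact ⟨g root / d root, fun i ↦ key n i (hiter i)⟩

/-- The coefficient of index `i` of the combination of simple roots coded by `c` in base 10. -/
def digit (c i : ℕ) : ℕ := c / 10 ^ i % 10

/-- The value on the `j`-th simple coroot of the combination of simple roots coded by `c`. -/
def codedPairing {n : ℕ} (C : Matrix (Fin n) (Fin n) ℤ) (c : ℕ) (j : Fin n) : ℤ :=
  ((List.finRange n).map fun i : Fin n ↦ (digit c i : ℤ) * C i j).sum

/-- The image of the combination of simple roots coded by `c` under the `j`-th simple
reflection. -/
def codedReflection {n : ℕ} (C : Matrix (Fin n) (Fin n) ℤ) (c : ℕ) (j : Fin n) : ℕ :=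
  ((c : ℤ) - codedPairing C c j * 10 ^ (j : ℕ)).toNat

/-- The value at the combination of simple roots coded by `c` of the functional `f`. -/
def codedValue {n : ℕ} (f : Fin n → ℤ) (c : ℕ) : ℤ :=
  ((List.finRange n).map fun i : Fin n ↦ (digit c i : ℤ) * f i).sum

/-- The combinatorial properties of the list of the positive roots of a root system, coded in
base 10, which are used to build a `PositiveRootModel`. -/
structure IsPositiveRootTable {n : ℕ} (C : Matrix (Fin n) (Fin n) ℤ) (L : List ℕ) (top : ℕ)
    (sq : Fin n → ℤ) (s p q : ℤ) : Prop where
  nodup : L.Nodup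
  eq_sum_digit : ∀ c ∈ L, c = ((List.finRange n).map fun i : Fin n ↦ digit c i * 10 ^ (i : ℕ)).sum
  simple_mem : ∀ i : Fin n, 10 ^ (i : ℕ) ∈ L
  diag : ∀ i, C i i = 2
  digit_simple : ∀ i k : Fin n, digit (10 ^ (i : ℕ)) k = if k = i then 1 else 0
  reflection : ∀ c ∈ L, ∀ j : Fin n, c = 10 ^ (j : ℕ) ∨ (codedReflection C c j ∈ L ∧
    ∀ i : Fin n, (digit (codedReflection C c j) i : ℤ) =
      digit c i - if i = j then codedPairing C c j else 0)
  descent : ∀ c ∈ L, (∃ i : Fin n, c = 10 ^ (i : ℕ)) ∨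
    ∃ j : Fin n, c ≠ 10 ^ (j : ℕ) ∧ 0 < codedPairing C c j
  top_mem : top ∈ L
  ascent : ∀ c ∈ L, c = top ∨ ∃ i : Fin n, c + 10 ^ (i : ℕ) ∈ L ∧
    ∀ k : Fin n, digit (c + 10 ^ (i : ℕ)) k = digit c k + if k = i then 1 else 0
  value_ne_zero : ∀ c ∈ L, codedValue sq c ≠ 0
  -- To stay among the integers all scalar products are multiplied by `s`: half the square of the
  -- `i`-th simple root is `sq i / s`, while `β/2 = p/s` and `γ/2 = q/s`.
  value_top : codedValue sq top = 2 * p + 2 * q - 3 * s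
  top_top : codedValue (fun i ↦ codedPairing C top i * sq i) top = 2 * s
  perm : (L.map (fun c ↦ codedValue (fun i ↦ codedPairing C top i * sq i) c + codedValue sq c) ++
      [s, p, q]).Perm
    (L.map (codedValue sq) ++ [2 * p + 2 * q - s, p + 2 * q - 2 * s, 2 * p + q - 2 * s])

namespace IsPositiveRootTable

variable {n : ℕ} {C : Matrix (Fin n) (Fin n) ℤ} {L : List ℕ} {top : ℕ} {sq : Fin n → ℤ}
  {s p q : ℤ}

/-- The vector of the coefficients of the combination of simple roots coded by `c`. -/
noncomputable def codedVec (n : ℕ) (c : ℕ) : Fin n → ℂ := fun i ↦ (digit c i : ℂ)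

/-- The linear functional with values `f i` at the simple roots. -/
noncomputable def functional (f : Fin n → ℂ) : (Fin n → ℂ) →ₗ[ℂ] ℂ :=
  ∑ i, f i • LinearMap.proj i

theorem functional_apply (f v : Fin n → ℂ) : functional f v = ∑ i, f i * v i := by
  simp [functional]

theorem functional_codedVec (f : Fin n → ℤ) (c : ℕ) :
    functional (fun i ↦ (f i : ℂ)) (codedVec n c) = codedValue f c := by
  rw [functional_apply, codedValue, ← Fin.sum_univ_def]
  push_cast
  exact Finset.sum_congr rfl fun i _ ↦ mul_comm _ _

theorem functional_codedVec_pairing (c : ℕ) (j : Fin n) :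
    functional (fun i ↦ (C i j : ℂ)) (codedVec n c) = codedPairing C c j :=
  functional_codedVec (fun i ↦ C i j) c

theorem functional_single (f : Fin n → ℂ) (i : Fin n) : functional f (Pi.single i 1) = f i := by
  simp [functional_apply, Pi.single_apply]

variable (h : IsPositiveRootTable C L top sq s p q)

include h

theorem codedVec_simple (i : Fin n) : codedVec n (10 ^ (i : ℕ)) = Pi.single i 1 := by
  ext k
  rw [codedVec, h.digit_simple, Pi.single_apply]
  split_ifs <;> simp

theorem codedVec_injOn {c c' : ℕ} (hc : c ∈ L) (hc' : c' ∈ L)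
    (h1 : codedVec n c = codedVec n c') : c = c' := by
  rw [h.eq_sum_digit c hc, h.eq_sum_digit c' hc']
  congr 2
  ext i
  have : digit c i = digit c' i := Nat.cast_injective (R := ℂ) (congrFun h1 i)
  rw [this]

theorem codedVec_reflection {c : ℕ} (hc : c ∈ L) {j : Fin n} (hj : c ≠ 10 ^ (j : ℕ)) :
    codedReflection C c j ∈ L ∧ codedVec n (codedReflection C c j) =
      codedVec n c - (codedPairing C c j : ℂ) • Pi.single j 1 := by
  obtain ⟨h1, h2⟩ := (h.reflection c hc j).resolve_left hj
  refine ⟨h1, ?_⟩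
  ext i
  have h3 : (digit (codedReflection C c j) i : ℂ) =
      digit c i - (if i = j then codedPairing C c j else 0 : ℤ) := by exact_mod_cast h2 i
  rw [codedVec, h3, Pi.sub_apply, Pi.smul_apply, Pi.single_apply]
  split_ifs <;> simp [codedVec]

/-- Induction on the height, which is the sum of the digits. A root that is not simple has a
positive pairing with some simple coroot; the corresponding reflection lowers the height, and the
same reflection leads back. -/
theorem induction_reflection (Q : ℕ → Prop) (h0 : ∀ i : Fin n, Q (10 ^ (i : ℕ)))
    (h1 : ∀ (j : Fin n), ∀ c ∈ L, ∀ c' ∈ L, c ≠ 10 ^ (j : ℕ) →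
      codedVec n c' = codedVec n c - (codedPairing C c j : ℂ) • Pi.single j 1 → Q c → Q c') :
    ∀ c ∈ L, Q c := by
  intro c hc
  generalize hN : ∑ i : Fin n, digit c i = N
  induction N using Nat.strong_induction_on generalizing c with
  | _ N ih =>
    obtain ⟨i, rfl⟩ | ⟨j, hj, hpos⟩ := h.descent c hc
    · exact h0 i
    obtain ⟨hmem, hvec⟩ := h.codedVec_reflection hc hj
    have hpair : codedPairing C (codedReflection C c j) j = - codedPairing C c j := by
      have h2 := functional_codedVec_pairing (C := C) (codedReflection C c j) j
      rw [hvec, map_sub, map_smul, functional_codedVec_pairing, functional_single, h.diag] at h2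
      have h3 : (codedPairing C (codedReflection C c j) j : ℂ) =
          ((- codedPairing C c j : ℤ) : ℂ) := by
        rw [← h2]; push_cast [smul_eq_mul]; ring
      exact_mod_cast h3
    -- The lower root has negative pairing with the `j`-th coroot, so it is not `α_j`, whose pairing
    -- is `2`.
    refine h1 j _ hmem c hc (fun h2 ↦ ?_) ?_ (ih _ ?_ _ hmem rfl)
    · have h3 := functional_codedVec_pairing (C := C) (10 ^ (j : ℕ)) j
      rw [h.codedVec_simple, functional_single, h.diag, ← h2, hpair] at h3
      have h4 : (2 : ℤ) = - codedPairing C c j := by exact_mod_cast h3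
      lia
    · rw [hvec, hpair]
      push_cast
      module
    · rw [← hN]
      have h2 := (h.reflection c hc j).resolve_left hj
      have h3 : ∀ i : Fin n, digit (codedReflection C c j) i ≤ digit c i := fun i ↦ by
        have := h2.2 i
        split_ifs at this <;> lia
      refine Finset.sum_lt_sum (fun i _ ↦ h3 i) ⟨j, Finset.mem_univ j, ?_⟩
      have := h2.2 j
      rw [if_pos rfl] at this
      lia

omit h in
theorem map_univ_get (L : List ℕ) (F : ℕ → ℂ) :
    (Finset.univ : Finset (Fin L.length)).val.map (fun x ↦ F (L.get x)) = (L.map F : List ℂ) := by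
  rw [Fin.univ_val_map]
  congr 1
  conv_rhs => rw [← List.ofFn_get L, List.map_ofFn]
  rfl

theorem exists_get_eq_iff {c : ℕ} (hc : c ∈ L) : ∃ x, ∀ y, L.get y = c ↔ y = x := by
  obtain ⟨x, hx⟩ := List.mem_iff_get.mp hc
  refine ⟨x, fun y ↦ ⟨fun hy ↦ ?_, fun hy ↦ hy ▸ hx⟩⟩
  exact List.nodup_iff_injective_get.mp h.nodup (hy.trans hx.symm)

/-- The position of `c` in the table. -/
noncomputable def index {c : ℕ} (hc : c ∈ L) : Fin L.length := (h.exists_get_eq_iff hc).choose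

theorem get_eq_iff {c : ℕ} (hc : c ∈ L) (y : Fin L.length) : L.get y = c ↔ y = h.index hc :=
  (h.exists_get_eq_iff hc).choose_spec y

theorem get_index {c : ℕ} (hc : c ∈ L) : L.get (h.index hc) = c := (h.get_eq_iff hc _).mpr rfl

/-- The model of the positive roots given by a table. -/
noncomputable def model {β γ : ℂ} (hs : (s : ℂ) ≠ 0) (hβ : β * s = 2 * p) (hγ : γ * s = 2 * q)
    (hunique : ∀ g : Fin n → ℂ, (∀ i j, C i j * g j = C j i * g i) →
      ∃ k, ∀ i, g i = k * (sq i : ℂ)) :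
    PositiveRootModel C (Fin n → ℂ) (Fin L.length) β γ where
  vec x := codedVec n (L.get x)
  vec_injective x y hxy := List.nodup_iff_injective_get.mp h.nodup
    (h.codedVec_injOn (L.get_mem x) (L.get_mem y) hxy)
  simple i := h.index (h.simple_mem i)
  coroot j := functional fun i ↦ (C i j : ℂ)
  coroot_simple i j := by
    rw [h.get_index, h.codedVec_simple, functional_single]
  exists_reflection j x hx := by
    obtain ⟨h1, h2⟩ := h.codedVec_reflection (L.get_mem x) (mt (h.get_eq_iff _ _).mp hx)
    refine ⟨h.index h1, ?_⟩
    rw [h.get_index, h.get_index, h.codedVec_simple, h2, functional_codedVec_pairing]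
  induction_reflection Q h0 h1 x := by
    have key : ∀ c ∈ L, ∀ x : Fin L.length, L.get x = c → Q x := by
      refine h.induction_reflection _ (fun i x hx ↦ ?_) fun j c hc c' hc' hcj hcc' ih x hx ↦ ?_
      · rw [(h.get_eq_iff (h.simple_mem i) x).mp hx]
        exact h0 i
      · refine h1 j (h.index hc) x (fun h4 ↦ hcj ?_) ?_ (ih _ (h.get_index hc))
        · rw [← h.get_index hc, h4, h.get_index]
        · rw [hx, hcc', h.get_index, h.get_index, h.codedVec_simple, functional_codedVec_pairing]
    exact key _ (L.get_mem x) x rfl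
  top := h.index h.top_mem
  eq_top x hx := by
    rcases h.ascent (L.get x) (L.get_mem x) with h1 | ⟨i, h1, h2⟩
    · exact (h.get_eq_iff _ _).mp h1
    · refine absurd ?_ (hx i (h.index h1))
      rw [h.get_index, h.get_index, h.codedVec_simple]
      ext k
      rw [codedVec, h2 k, Pi.add_apply, Pi.single_apply]
      split_ifs <;> simp [codedVec]
  halfSq i := sq i / s
  halfSq_unique g hg := by
    obtain ⟨k, hk⟩ := hunique g hg
    refine ⟨k * s, fun i ↦ ?_⟩
    rw [hk]
    field_simp
  rhoForm := (s : ℂ)⁻¹ • functional fun i ↦ (sq i : ℂ)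
  rhoForm_simple i := by
    rw [h.get_index, h.codedVec_simple, LinearMap.smul_apply, functional_single, smul_eq_mul]
    field_simp
  rhoForm_ne_zero x := by
    rw [LinearMap.smul_apply, functional_codedVec]
    exact smul_ne_zero (inv_ne_zero hs) (by exact_mod_cast h.value_ne_zero _ (L.get_mem x))
  rhoForm_top := by
    rw [h.get_index, LinearMap.smul_apply, functional_codedVec, h.value_top, smul_eq_mul]
    push_cast
    rw [← hβ, ← hγ]
    field_simp
  topForm := (s : ℂ)⁻¹ • functional fun i ↦ ((codedPairing C top i * sq i : ℤ) : ℂ)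
  topForm_simple i := by
    rw [h.get_index, h.get_index, h.codedVec_simple, LinearMap.smul_apply, functional_single,
      smul_eq_mul, functional_codedVec_pairing]
    push_cast
    field_simp
  topForm_top := by
    rw [h.get_index, LinearMap.smul_apply, functional_codedVec, h.top_top, smul_eq_mul]
    push_cast
    field_simp
  shift := by
    -- Dividing the integral permutation by `s` gives the identity of multisets.
    have h1 := congrArg (Multiset.map fun z : ℤ ↦ (z : ℂ) / s) (Multiset.coe_eq_coe.mpr h.perm)
    have hp : (p : ℂ) / s = β / 2 := by field_simp; linear_combination -hβ
    have hq : (q : ℂ) / s = γ / 2 := by field_simp; linear_combination -hγ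
    have h2 : ((2 * p + 2 * q - s : ℤ) : ℂ) / s = β + γ - 1 := by
      push_cast; field_simp; linear_combination -hβ - hγ
    have h3 : ((p + 2 * q - 2 * s : ℤ) : ℂ) / s = β / 2 + γ - 2 := by
      push_cast; field_simp; linear_combination -hβ - 2 * hγ
    have h4 : ((2 * p + q - 2 * s : ℤ) : ℂ) / s = β + γ / 2 - 2 := by
      push_cast; field_simp; linear_combination -2 * hβ - hγ
    rw [Multiset.map_coe, Multiset.map_coe, List.map_append, List.map_append, List.map_map,
      List.map_map, ← Multiset.coe_add, ← Multiset.coe_add] at h1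
    simp only [List.map_cons, List.map_nil, h2, h3, h4, hp, hq, div_self hs] at h1
    simp only [LinearMap.smul_apply, functional_codedVec]
    rw [← map_univ_get, ← map_univ_get] at h1
    convert! h1 using 4 with x x
    · simp only [Function.comp_apply, smul_eq_mul]
      push_cast
      field_simp
    · simp only [Function.comp_apply, smul_eq_mul]
      field_simp

end IsPositiveRootTable

/-! ### The exceptional types. -/

/-- The positive roots of type `G₂`. -/
def tableG₂ : List ℕ := [
10, 1, 11, 21, 31, 32]

/-- The scale is `s = 3`, so that the short simple root has the integral weight `1`; then `β/2 =
5/3` and `γ/2 = 4/3`. -/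
theorem isPositiveRootTable_G₂ :
    IsPositiveRootTable CartanMatrix.G₂ tableG₂ 32 ![3, 1] 3 5 4 where
  nodup := by decide +kernel
  eq_sum_digit := by decide +kernel
  simple_mem := by decide +kernel
  diag := by decide +kernel
  digit_simple := by decide +kernel
  reflection := by decide +kernel
  descent := by decide +kernel
  top_mem := by decide +kernel
  ascent := by decide +kernel
  value_ne_zero := by decide +kernel
  value_top := by decide +kernel
  top_top := by decide +kernel
  perm := by decide +kernel

theorem exists_eq_mul_G₂ (g : Fin 2 → ℂ)
    (hg : ∀ i j, CartanMatrix.G₂ i j * g j = CartanMatrix.G₂ j i * g i) :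
    ∃ k, ∀ i, g i = k * (((![3, 1]) : Fin 2 → ℤ) i : ℂ) :=
  exists_eq_mul_of_parent _ ![0, 0] 0 (by decide) (by decide +kernel) (by decide +kernel) g hg

/-- The positive roots of type `F₄`. -/
def tableF₄ : List ℕ := [
1000, 100, 10, 1, 1100, 110, 11, 1110, 210, 111, 1210, 1111, 211, 2210, 1211, 221, 2211, 1221,
2221, 1321, 2321, 2421, 2431, 2432]

theorem isPositiveRootTable_F₄ :
    IsPositiveRootTable CartanMatrix.F₄ tableF₄ 2432 ![2, 2, 1, 1] 2 5 6 where
  nodup := by decide +kernel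
  eq_sum_digit := by decide +kernel
  simple_mem := by decide +kernel
  diag := by decide +kernel
  digit_simple := by decide +kernel
  reflection := by decide +kernel
  descent := by decide +kernel
  top_mem := by decide +kernel
  ascent := by decide +kernel
  value_ne_zero := by decide +kernel
  value_top := by decide +kernel
  top_top := by decide +kernel
  perm := by decide +kernel

theorem exists_eq_mul_F₄ (g : Fin 4 → ℂ)
    (hg : ∀ i j, CartanMatrix.F₄ i j * g j = CartanMatrix.F₄ j i * g i) :
    ∃ k, ∀ i, g i = k * (((![2, 2, 1, 1]) : Fin 4 → ℤ) i : ℂ) :=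
  exists_eq_mul_of_parent _ ![0, 0, 1, 2] 0 (by decide) (by decide +kernel) (by decide +kernel) g hg

/-- The positive roots of type `E₆`. -/
def tableE₆ : List ℕ := [
100000, 10000, 1000, 100, 10, 1, 110000, 11000, 1100, 1010, 101, 111000, 11100, 11010, 1110,
1101, 111100, 111010, 11110, 11101, 1111, 111110, 12110, 111101, 11111, 112110, 111111, 12111,
122110, 112111, 12211, 122111, 112211, 122211, 123211, 123221]

theorem isPositiveRootTable_E₆ :
    IsPositiveRootTable CartanMatrix.E₆ tableE₆ 123221 (fun _ ↦ 1) 1 3 4 where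
  nodup := by decide +kernel
  eq_sum_digit := by decide +kernel
  simple_mem := by decide +kernel
  diag := by decide +kernel
  digit_simple := by decide +kernel
  reflection := by decide +kernel
  descent := by decide +kernel
  top_mem := by decide +kernel
  ascent := by decide +kernel
  value_ne_zero := by decide +kernel
  value_top := by decide +kernel
  top_top := by decide +kernel
  perm := by decide +kernel

theorem exists_eq_mul_E₆ (g : Fin 6 → ℂ)
    (hg : ∀ i j, CartanMatrix.E₆ i j * g j = CartanMatrix.E₆ j i * g i) :
    ∃ k, ∀ i, g i = k * (((fun _ ↦ 1) : Fin 6 → ℤ) i : ℂ) :=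
  -- The tree is rooted at the branching node, which has index `3`; the same choice serves `E₇` and
  -- `E₈`.
  exists_eq_mul_of_parent _ ![2, 3, 3, 3, 3, 4] 3 (by decide) (by decide +kernel) (by decide +kernel) g hg

/-- The positive roots of type `E₇`. -/
def tableE₇ : List ℕ := [
1000000, 100000, 10000, 1000, 100, 10, 1, 1100000, 110000, 11000, 1100, 1010, 101, 1110000,
111000, 11100, 11010, 1110, 1101, 1111000, 111100, 111010, 11110, 11101, 1111, 1111100, 1111010,
111110, 12110, 111101, 11111, 1111110, 112110, 1111101, 111111, 12111, 1112110, 122110, 1111111,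
112111, 12211, 1122110, 1112111, 122111, 112211, 1222110, 1122111, 1112211, 122211, 1222111,
1122211, 123211, 1222211, 1123211, 123221, 1223211, 1123221, 1233211, 1223221, 1233221, 1234221,
1234321, 1234322]

theorem isPositiveRootTable_E₇ :
    IsPositiveRootTable CartanMatrix.E₇ tableE₇ 1234322 (fun _ ↦ 1) 1 4 6 where
  nodup := by decide +kernel
  eq_sum_digit := by decide +kernel
  simple_mem := by decide +kernel
  diag := by decide +kernel
  digit_simple := by decide +kernel
  reflection := by decide +kernel
  descent := by decide +kernel
  top_mem := by decide +kernel
  ascent := by decide +kernel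
  value_ne_zero := by decide +kernel
  value_top := by decide +kernel
  top_top := by decide +kernel
  perm := by decide +kernel

theorem exists_eq_mul_E₇ (g : Fin 7 → ℂ)
    (hg : ∀ i j, CartanMatrix.E₇ i j * g j = CartanMatrix.E₇ j i * g i) :
    ∃ k, ∀ i, g i = k * (((fun _ ↦ 1) : Fin 7 → ℤ) i : ℂ) :=
  exists_eq_mul_of_parent _ ![2, 3, 3, 3, 3, 4, 5] 3 (by decide) (by decide +kernel) (by decide +kernel) g hg

/-- The positive roots of type `E₈`. -/
def tableE₈ : List ℕ := [
10000000, 1000000, 100000, 10000, 1000, 100, 10, 1, 11000000, 1100000, 110000, 11000, 1100,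
1010, 101, 11100000, 1110000, 111000, 11100, 11010, 1110, 1101, 11110000, 1111000, 111100,
111010, 11110, 11101, 1111, 11111000, 1111100, 1111010, 111110, 12110, 111101, 11111, 11111100,
11111010, 1111110, 112110, 1111101, 111111, 12111, 11111110, 1112110, 122110, 11111101, 1111111,
112111, 12211, 11112110, 1122110, 11111111, 1112111, 122111, 112211, 11122110, 1222110,
11112111, 1122111, 1112211, 122211, 11222110, 11122111, 1222111, 11112211, 1122211, 123211,
12222110, 11222111, 11122211, 1222211, 1123211, 123221, 12222111, 11222211, 11123211, 1223211,
1123221, 12222211, 11223211, 1233211, 11123221, 1223221, 12223211, 11233211, 11223221, 1233221,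
12233211, 12223221, 11233221, 1234221, 12333211, 12233221, 11234221, 1234321, 12333221,
12234221, 11234321, 1234322, 12334221, 12234321, 11234322, 12344221, 12334321, 12234322,
12344321, 12334322, 12345321, 12344322, 12345331, 12345322, 12345422, 12345332, 12345432,
12346432, 12356432, 12456432, 13456432, 23456432]

theorem isPositiveRootTable_E₈ :
    IsPositiveRootTable CartanMatrix.E₈ tableE₈ 23456432 (fun _ ↦ 1) 1 6 10 where
  nodup := by decide +kernel
  eq_sum_digit := by decide +kernel
  simple_mem := by decide +kernel
  diag := by decide +kernel
  digit_simple := by decide +kernel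
  reflection := by decide +kernel
  descent := by decide +kernel
  top_mem := by decide +kernel
  ascent := by decide +kernel
  value_ne_zero := by decide +kernel
  value_top := by decide +kernel
  top_top := by decide +kernel
  perm := by decide +kernel

theorem exists_eq_mul_E₈ (g : Fin 8 → ℂ)
    (hg : ∀ i j, CartanMatrix.E₈ i j * g j = CartanMatrix.E₈ j i * g i) :
    ∃ k, ∀ i, g i = k * (((fun _ ↦ 1) : Fin 8 → ℤ) i : ℂ) :=
  exists_eq_mul_of_parent _ ![2, 3, 3, 3, 3, 4, 5, 6] 3 (by decide) (by decide +kernel) (by decide +kernel) g hg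

/-! ### Equality of multisets from sums of test functions. -/

/-- Taking for `f` the indicator of a point compares multiplicities. -/
theorem multiset_map_add_eq_of_sum {κ : Type} [Fintype κ] (a c : κ → ℂ) (q₁ q₂ q₃ p₁ p₂ p₃ : ℂ)
    (h : ∀ f : ℂ → ℤ, ∑ x, (f (a x) - f (c x)) =
      f p₁ + f p₂ + f p₃ - (f q₁ + f q₂ + f q₃)) :
    Finset.univ.val.map a + {q₁, q₂, q₃} = Finset.univ.val.map c + {p₁, p₂, p₃} := by
  classical
  have hcount : ∀ (g : κ → ℂ) (z : ℂ), ((Finset.univ.val.map g).count z : ℤ) =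
      ∑ x, if z = g x then 1 else 0 := fun g z ↦ by
    have h1 : Finset.univ.val.map g = ∑ x, ({g x} : Multiset ℂ) := by
      rw [← Multiset.sum_map_singleton (Finset.univ.val.map g), Multiset.map_map]
      rfl
    rw [h1, Multiset.count_sum']
    push_cast [Multiset.count_singleton]
    rfl
  ext z
  have h1 := h fun w ↦ if z = w then 1 else 0
  rw [Finset.sum_sub_distrib, ← hcount, ← hcount] at h1
  simp only [Multiset.count_add, Multiset.insert_eq_cons, Multiset.count_cons,
    Multiset.count_singleton]
  zify
  linear_combination h1

/-- In the classical types all values are half-integers; once doubled, they allow telescoping with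
functions on `ℤ`. -/
theorem multiset_map_add_eq_of_sum_half {κ : Type} [Fintype κ] {a c : κ → ℂ} (A C : κ → ℤ)
    (Q₁ Q₂ Q₃ P₁ P₂ P₃ : ℤ) {q₁ q₂ q₃ p₁ p₂ p₃ : ℂ} (ha : ∀ x, a x = A x / 2)
    (hc : ∀ x, c x = C x / 2) (hq₁ : q₁ = Q₁ / 2) (hq₂ : q₂ = Q₂ / 2) (hq₃ : q₃ = Q₃ / 2)
    (hp₁ : p₁ = P₁ / 2) (hp₂ : p₂ = P₂ / 2) (hp₃ : p₃ = P₃ / 2)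
    (h : ∀ f : ℤ → ℤ, ∑ x, (f (A x) - f (C x)) = f P₁ + f P₂ + f P₃ - (f Q₁ + f Q₂ + f Q₃)) :
    Finset.univ.val.map a + {q₁, q₂, q₃} = Finset.univ.val.map c + {p₁, p₂, p₃} := by
  refine multiset_map_add_eq_of_sum a c q₁ q₂ q₃ p₁ p₂ p₃ fun f ↦ ?_
  simp only [ha, hc, hq₁, hq₂, hq₃, hp₁, hp₂, hp₃]
  exact h fun z ↦ f (z / 2)

/-- This covers diagrams that are chains, node `i` hanging on node `i - 1`. Truncated subtraction
makes `0` a fixed point of the parent map. -/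
theorem exists_eq_mul_of_pred {m : ℕ} {C : Matrix (Fin (m + 1)) (Fin (m + 1)) ℤ}
    (d : Fin (m + 1) → ℤ) (hd : d 0 ≠ 0)
    (hC : ∀ i j : Fin (m + 1), (j : ℕ) + 1 = i → C j i ≠ 0 ∧ C i j * d j = C j i * d i)
    (g : Fin (m + 1) → ℂ) (hg : ∀ i j, C i j * g j = C j i * g i) :
    ∃ k, ∀ i, g i = k * (d i : ℂ) := by
  refine exists_eq_mul_of_parent d (fun i ↦ ⟨i - 1, by lia⟩) 0 hd (fun i ↦ ?_)
    (fun i hi ↦ hC i _ ?_) g hg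
  · have h : ∀ (k : ℕ) (i : Fin (m + 1)),
        ((fun i : Fin (m + 1) ↦ (⟨i - 1, by lia⟩ : Fin (m + 1)))^[k] i : ℕ) = i - k := by
      intro k
      induction k with
      | zero => simp
      | succ k ih => intro i; rw [Function.iterate_succ_apply, ih]; simp only; lia
    rw [Fin.ext_iff, h, Fin.val_zero]
    lia
  · have : (i : ℕ) ≠ 0 := fun h ↦ hi (Fin.ext h)
    simp only
    lia

/-! ### Coordinate vectors, pairs of indices and adjacent transpositions. -/

section Coordinates

/-- The `i`-th coordinate vector. -/
noncomputable def coordVec (i : ℕ) : ℕ →₀ ℂ := Finsupp.single i 1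

/-- The linear functional with the value `c i` at the `i`-th coordinate vector. -/
noncomputable def coordForm (c : ℕ → ℂ) : (ℕ →₀ ℂ) →ₗ[ℂ] ℂ := Finsupp.linearCombination ℂ c

@[simp]
theorem coordForm_coordVec (c : ℕ → ℂ) (i : ℕ) : coordForm c (coordVec i) = c i := by
  simp [coordForm, coordVec]

theorem coordVec_apply (i j : ℕ) : coordVec i j = if i = j then 1 else 0 :=
  Finsupp.single_apply

/-- The pairs `i < j < N`, presented as `⟨j, i⟩`. -/
abbrev Pairs (N : ℕ) : Type := (j : Fin N) × Fin j

/-- The pair `i < j`. -/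
abbrev Pairs.mk {N : ℕ} (i j : ℕ) (hij : i < j) (hj : j < N) : Pairs N := ⟨⟨j, hj⟩, ⟨i, hij⟩⟩

theorem Pairs.sum_eq {A : Type*} [AddCommMonoid A] {N : ℕ} (F : ℕ → ℕ → A) :
    ∑ x : Pairs N, F x.2 x.1 = ∑ j ∈ Finset.range N, ∑ i ∈ Finset.range j, F i j := by
  rw [Fintype.sum_sigma, Finset.sum_range]
  refine Finset.sum_congr rfl fun j _ ↦ ?_
  rw [Finset.sum_range]

theorem Pairs.card_add (N : ℕ) : 2 * Fintype.card (Pairs N) + N = N ^ 2 := by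
  have h : Fintype.card (Pairs N) = ∑ j ∈ Finset.range N, j := by
    rw [Fintype.card_sigma, Finset.sum_range]
    simp
  rw [h, mul_comm, Finset.sum_range_id_mul_two]
  cases N with
  | zero => rfl
  | succ N => rw [Nat.add_sub_cancel]; ring

/-- The transposition of `k` and `k + 1`. -/
def adjSwap (k i : ℕ) : ℕ := if i = k then k + 1 else if i = k + 1 then k else i

/-- The coroot of `ε_k - ε_{k+1}`. -/
noncomputable def adjCoroot (k : ℕ) : (ℕ →₀ ℂ) →ₗ[ℂ] ℂ :=
  coordForm fun i ↦ if i = k then 1 else if i = k + 1 then -1 else 0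

/-- The reflection in `ε_k - ε_{k+1}` exchanges these two coordinates. -/
theorem coordVec_adjSwap (k i : ℕ) : coordVec (adjSwap k i) =
    coordVec i - adjCoroot k (coordVec i) • (coordVec k - coordVec (k + 1)) := by
  rw [adjCoroot, coordForm_coordVec, adjSwap]
  split_ifs with h1 h2
  · rw [h1]; module
  · rw [h2]; module
  · module

/-- The vectors `ε_i - ε_j`. -/
noncomputable def subVec {N : ℕ} (x : Pairs N) : ℕ →₀ ℂ := coordVec x.2 - coordVec x.1

/-- The vectors `ε_i + ε_j`. -/
noncomputable def addVec {N : ℕ} (x : Pairs N) : ℕ →₀ ℂ := coordVec x.2 + coordVec x.1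

theorem Pairs.ext_iff {N : ℕ} {x y : Pairs N} :
    x = y ↔ (x.2 : ℕ) = y.2 ∧ (x.1 : ℕ) = y.1 := by
  obtain ⟨⟨j, hj⟩, ⟨i, hi⟩⟩ := x
  obtain ⟨⟨j', hj'⟩, ⟨i', hi'⟩⟩ := y
  refine ⟨fun h ↦ by cases h; exact ⟨rfl, rfl⟩, fun ⟨h1, h2⟩ ↦ ?_⟩
  simp only at h1 h2
  subst h1 h2
  rfl

/-- Made for `ε_i - ε_j`, reached from `ε_i - ε_{i+1}` by raising `j`. -/
theorem Pairs.induction_up {N : ℕ} {Q : Pairs N → Prop}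
    (h1 : ∀ k (hk : k + 1 < N), Q (Pairs.mk k (k + 1) (by lia) hk))
    (h2 : ∀ i j (hij : i < j) (hj : j + 1 < N), Q (Pairs.mk i j hij (by lia)) →
      Q (Pairs.mk i (j + 1) (by lia) hj)) (x : Pairs N) : Q x := by
  have h3 : ∀ j i (hij : i < j) (hj : j < N), Q (Pairs.mk i j hij hj) := by
    intro j
    induction j with
    | zero => intro i hij; lia
    | succ j ih =>
      intro i hij hj
      rcases Nat.lt_succ_iff_lt_or_eq.mp hij with h | rfl
      · exact h2 i j h hj (ih i h _)
      · exact h1 i hj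
  exact h3 _ _ x.2.2 x.1.2

/-- Made for `ε_i + ε_j`, reached from the last possible `j` by lowering it. -/
theorem Pairs.induction_down {N : ℕ} {Q : Pairs (N + 1) → Prop}
    (h1 : ∀ i (hi : i < N), Q (Pairs.mk i N hi (by lia)))
    (h2 : ∀ i j (hij : i < j) (hj : j < N), Q (Pairs.mk i (j + 1) (by lia) (by lia)) →
      Q (Pairs.mk i j hij (by lia))) (x : Pairs (N + 1)) : Q x := by
  have h3 : ∀ k i j (hij : i < j) (hj : j < N + 1), j + k = N → Q (Pairs.mk i j hij hj) := by
    intro k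
    induction k with
    | zero => rintro i j hij hj rfl; exact h1 i hij
    | succ k ih =>
      intro i j hij hj hk
      exact h2 i j hij (by lia) (ih i (j + 1) (by lia) (by lia) (by lia))
  exact h3 (N - x.1) _ _ x.2.2 x.1.2 (by lia)

theorem subVec_injective {N : ℕ} : Function.Injective (subVec (N := N)) := by
  rintro ⟨⟨j, hj⟩, ⟨i, hi⟩⟩ ⟨⟨j', hj'⟩, ⟨i', hi'⟩⟩ h
  rw [Pairs.ext_iff]
  have h1 := DFunLike.congr_fun h i
  have h2 := DFunLike.congr_fun h j
  simp only [subVec, Finsupp.sub_apply, coordVec_apply] at h1 h2 ⊢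
  split_ifs at h1 h2 <;> first | lia | (norm_num at h1; done) | norm_num at h2

theorem addVec_injective {N : ℕ} : Function.Injective (addVec (N := N)) := by
  rintro ⟨⟨j, hj⟩, ⟨i, hi⟩⟩ ⟨⟨j', hj'⟩, ⟨i', hi'⟩⟩ h
  rw [Pairs.ext_iff]
  have h1 := DFunLike.congr_fun h i
  have h2 := DFunLike.congr_fun h j
  simp only [addVec, Finsupp.add_apply, coordVec_apply] at h1 h2 ⊢
  split_ifs at h1 h2 <;> first | lia | (norm_num at h1; done) | norm_num at h2

/-- An adjacent transposition reverses the order of no pair but `(k, k + 1)`. -/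
theorem exists_subVec_eq_adjSwap {N k : ℕ} (hk : k + 1 < N) (x : Pairs N)
    (hx : x ≠ Pairs.mk k (k + 1) (by lia) hk) :
    ∃ y : Pairs N, subVec y = subVec x -
      adjCoroot k (subVec x) • subVec (Pairs.mk k (k + 1) (by lia) hk) := by
  obtain ⟨⟨j, hj⟩, ⟨i, hi⟩⟩ := x
  simp only at hi
  have hx' : ¬ (i = k ∧ j = k + 1) := fun h ↦ hx (Pairs.ext_iff.mpr h)
  refine ⟨Pairs.mk (adjSwap k i) (adjSwap k j) ?_ ?_, ?_⟩
  · unfold adjSwap; split_ifs <;> lia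
  · unfold adjSwap; split_ifs <;> lia
  · simp only [subVec, coordVec_adjSwap, map_sub]
    module

theorem exists_addVec_eq {N a b : ℕ} (hab : a ≠ b) (ha : a < N) (hb : b < N) :
    ∃ y : Pairs N, addVec y = coordVec a + coordVec b := by
  rcases lt_or_gt_of_ne hab with h | h
  · exact ⟨Pairs.mk a b h hb, rfl⟩
  · exact ⟨Pairs.mk b a h ha, add_comm _ _⟩

/-- No pair is excluded here, since `ε_i + ε_j` does not depend on the order of `i` and `j`. -/
theorem exists_addVec_eq_adjSwap {N k : ℕ} (hk : k + 1 < N) (x : Pairs N) :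
    ∃ y : Pairs N, addVec y = addVec x -
      adjCoroot k (addVec x) • subVec (Pairs.mk k (k + 1) (by lia) hk) := by
  obtain ⟨⟨j, hj⟩, ⟨i, hi⟩⟩ := x
  simp only at hi
  obtain ⟨y, hy⟩ := exists_addVec_eq (N := N) (a := adjSwap k i) (b := adjSwap k j)
    (by unfold adjSwap; split_ifs <;> lia) (by unfold adjSwap; split_ifs <;> lia)
    (by unfold adjSwap; split_ifs <;> lia)
  refine ⟨y, ?_⟩
  rw [hy, coordVec_adjSwap, coordVec_adjSwap]
  simp only [subVec, addVec, map_add]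
  module

theorem subVec_succ_right {N i j : ℕ} (hij : i < j) (hj : j + 1 < N) :
    subVec (Pairs.mk i (j + 1) (by lia) hj) = subVec (Pairs.mk (N := N) i j hij (by lia)) -
      adjCoroot j (subVec (Pairs.mk (N := N) i j hij (by lia))) •
        subVec (Pairs.mk j (j + 1) (by lia) hj) := by
  have h1 : ¬ i = j := by lia
  have h2 : ¬ i = j + 1 := by lia
  simp only [subVec, adjCoroot, map_sub, coordForm_coordVec, h1, h2, if_true, if_false]
  module

theorem addVec_pred_right {N i j : ℕ} (hij : i < j) (hj : j + 1 < N) :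
    addVec (Pairs.mk (N := N) i j hij (by lia)) = addVec (Pairs.mk i (j + 1) (by lia) hj) -
      adjCoroot j (addVec (Pairs.mk i (j + 1) (by lia) hj)) •
        subVec (Pairs.mk j (j + 1) (by lia) hj) := by
  have h1 : ¬ i = j := by lia
  have h2 : ¬ i = j + 1 := by lia
  simp only [subVec, addVec, adjCoroot, map_add, coordForm_coordVec, h1, h2, if_true, if_false,
    one_ne_zero, add_eq_left]
  module

end Coordinates

/-! ### Telescoping sums over pairs. -/

section Sums

theorem sum_pairs_eq_of_two_rows {m : ℕ} (F : ℕ → ℕ → ℤ)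
    (hF : ∀ i j, i + 2 < j → F (i + 2) j = 0) :
    ∑ j ∈ Finset.range (m + 2), ∑ i ∈ Finset.range j, F i j =
      F 0 1 + ∑ j ∈ Finset.range m, (F 0 (j + 2) + F 1 (j + 2)) := by
  have h1 : ∀ j, ∑ i ∈ Finset.range (j + 2), F i (j + 2) = F 0 (j + 2) + F 1 (j + 2) := fun j ↦ by
    rw [Finset.sum_range_succ', Finset.sum_range_succ', Finset.sum_eq_zero fun i hi ↦
      hF i (j + 2) (by have := Finset.mem_range.mp hi; lia)]
    ring
  rw [Finset.sum_range_succ', Finset.sum_range_succ', Finset.sum_congr rfl fun j _ ↦ h1 j,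
    Finset.sum_range_zero, zero_add, Finset.sum_range_one]
  ring

theorem sum_pairs_eq_of_one_row {m : ℕ} (F : ℕ → ℕ → ℤ)
    (hF : ∀ i j, i + 1 < j → F (i + 1) j = 0) :
    ∑ j ∈ Finset.range (m + 1), ∑ i ∈ Finset.range j, F i j =
      ∑ j ∈ Finset.range m, F 0 (j + 1) := by
  have h1 : ∀ j, ∑ i ∈ Finset.range (j + 1), F i (j + 1) = F 0 (j + 1) := fun j ↦ by
    rw [Finset.sum_range_succ', Finset.sum_eq_zero fun i hi ↦
      hF i (j + 1) (by have := Finset.mem_range.mp hi; lia), zero_add]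
  rw [Finset.sum_range_succ', Finset.sum_congr rfl fun j _ ↦ h1 j, Finset.sum_range_zero, add_zero]

theorem sum_range_add_two_sub (g : ℕ → ℤ) (k : ℕ) :
    ∑ j ∈ Finset.range k, (g (j + 2) - g j) = g (k + 1) + g k - (g 1 + g 0) := by
  induction k with
  | zero => simp
  | succ k ih => rw [Finset.sum_range_succ, ih]; ring

/-- The highest root is `ε_0 - ε_{m+1}`, so only the roots with `i = 0` or `j = m + 1` move. The row
and the column each telescope by steps of `2`, and the corner, which lies in both, moves by `4`. -/
theorem sum_shift_A (h : ℤ → ℤ) (m : ℕ) :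
    ∑ x : Pairs (m + 2), (h ((if (x.2 : ℕ) = 0 then 2 else 0) +
      (if (x.1 : ℕ) = m + 1 then 2 else 0) + (2 * (x.1 : ℕ) - 2 * (x.2 : ℕ))) -
        h (2 * (x.1 : ℕ) - 2 * (x.2 : ℕ))) =
      h (2 * m + 6) + h (2 * m + 2) - (h 2 + h 2) := by
  rw [Pairs.sum_eq fun i j ↦ h ((if i = 0 then 2 else 0) +
      (if j = m + 1 then 2 else 0) + (2 * (j : ℕ) - 2 * (i : ℕ))) - h (2 * (j : ℕ) - 2 * (i : ℕ)),
    Finset.sum_range_succ, Finset.sum_range_succ']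
  have h1 : ∀ j ∈ Finset.range m, ∑ i ∈ Finset.range (j + 1),
      (h ((if i = 0 then 2 else 0) + (if j + 1 = m + 1 then 2 else 0) +
        (2 * (j + 1 : ℕ) - 2 * (i : ℕ))) - h (2 * (j + 1 : ℕ) - 2 * (i : ℕ))) =
      h (2 * ((j + 1 : ℕ) + 1)) - h (2 * (j + 1)) := fun j hj ↦ by
    have h2 : ¬ j + 1 = m + 1 := by have := Finset.mem_range.mp hj; lia
    rw [Finset.sum_range_succ']
    simp only [h2, if_false, Nat.add_eq_zero_iff, one_ne_zero, and_false, zero_add, sub_self,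
      Finset.sum_const_zero, if_true, add_zero]
    congr 2
    push_cast
    ring
  have h2 : ∑ i ∈ Finset.range (m + 1),
      (h ((if i = 0 then 2 else 0) + (if m + 1 = m + 1 then 2 else 0) +
        (2 * (m + 1 : ℕ) - 2 * (i : ℕ))) - h (2 * (m + 1 : ℕ) - 2 * (i : ℕ))) =
      ∑ i ∈ Finset.range m, (h (2 * (m + 1) - 2 * (i : ℕ)) - h (2 * (m + 1) - 2 * (i + 1 : ℕ))) +
        (h (2 * m + 6) - h (2 * m + 2)) := by
    rw [Finset.sum_range_succ']
    congr 1
    · refine Finset.sum_congr rfl fun i _ ↦ ?_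
      rw [if_neg (by lia), if_pos rfl]
      congr 2
      push_cast
      ring
    · rw [if_pos rfl, if_pos rfl]
      congr 2
      push_cast
      ring
  rw [Finset.sum_congr rfl h1, h2, Finset.sum_range_zero,
    Finset.sum_range_sub (fun j : ℕ ↦ h (2 * ((j : ℤ) + 1))),
    Finset.sum_range_sub' (fun j : ℕ ↦ h (2 * ((m : ℤ) + 1) - 2 * (j : ℕ)))]
  push_cast
  ring_nf

/-- The highest root is `ε_0 + ε_1`, so only the rows `0` and `1` move. The shifted row `1`
coincides with the unshifted row `0`, which leaves one difference for each further column. The sign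
`s` treats `ε_i + ε_j` and `ε_i - ε_j` together. -/
theorem sum_pairs_shift_BD (h : ℤ → ℤ) (m : ℕ) (s r : ℤ) :
    ∑ x : Pairs (m + 2), (h ((if (x.2 : ℕ) < 2 then 2 else 0) +
      s * (if (x.1 : ℕ) < 2 then 2 else 0) +
        ((r - 2 * (x.2 : ℕ)) + s * (r - 2 * (x.1 : ℕ)))) -
        h ((r - 2 * (x.2 : ℕ)) + s * (r - 2 * (x.1 : ℕ)))) =
      h (r + 2 + s * r) - h (r + s * (r - 2)) + ∑ j ∈ Finset.range m,
        (h (r + 2 + s * (r - 2 * (j + 2))) - h (r - 2 + s * (r - 2 * (j + 2)))) := by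
  rw [Pairs.sum_eq fun i j ↦ h ((if i < 2 then 2 else 0) +
    s * (if j < 2 then 2 else 0) + ((r - 2 * (i : ℕ)) + s * (r - 2 * (j : ℕ)))) -
      h ((r - 2 * (i : ℕ)) + s * (r - 2 * (j : ℕ))), sum_pairs_eq_of_two_rows]
  · congr 1
    · simp only [Nat.ofNat_pos, Nat.one_lt_ofNat, if_true]
      congr 2 <;> (push_cast; ring)
    · refine Finset.sum_congr rfl fun j _ ↦ ?_
      have h1 : ¬ j + 2 < 2 := by lia
      simp only [h1, if_false, Nat.ofNat_pos, Nat.one_lt_ofNat, if_true]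
      push_cast
      ring_nf
  · intro i j hij
    have h1 : ¬ i + 2 < 2 := by lia
    have h2 : ¬ j < 2 := by lia
    simp only [h1, h2, if_false, mul_zero, zero_add, sub_self]

theorem sum_pairs_shift_sub (h : ℤ → ℤ) (m : ℕ) (r : ℤ) :
    ∑ x : Pairs (m + 2), (h ((if (x.2 : ℕ) < 2 then 2 else 0) - (if (x.1 : ℕ) < 2 then 2 else 0) +
        ((r - 2 * (x.2 : ℕ)) - (r - 2 * (x.1 : ℕ)))) -
        h ((r - 2 * (x.2 : ℕ)) - (r - 2 * (x.1 : ℕ)))) =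
      h (2 * m + 4) - h 4 + (h (2 * m + 2) - h 2) := by
  have h1 := sum_pairs_shift_BD h m (-1) r
  simp only [neg_mul, one_mul, ← sub_eq_add_neg] at h1
  rw [h1, Finset.sum_congr rfl fun (j : ℕ) _ ↦ show _ = h (2 * (j + 2 : ℕ) + 2) - h (2 * j + 2) by
    congr 2 <;> (push_cast; ring), sum_range_add_two_sub fun j ↦ h (2 * j + 2)]
  push_cast
  ring_nf

theorem sum_pairs_shift_add (h : ℤ → ℤ) (m : ℕ) (r : ℤ) :
    ∑ x : Pairs (m + 2), (h ((if (x.2 : ℕ) < 2 then 2 else 0) + (if (x.1 : ℕ) < 2 then 2 else 0) +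
        ((r - 2 * (x.2 : ℕ)) + (r - 2 * (x.1 : ℕ)))) -
        h ((r - 2 * (x.2 : ℕ)) + (r - 2 * (x.1 : ℕ)))) =
      h (2 * r + 2) - h (2 * r - 2 - 2 * m) + (h (2 * r - 4) - h (2 * r - 4 - 2 * m)) := by
  have h1 := sum_pairs_shift_BD h m 1 r
  simp only [one_mul] at h1
  rw [h1, Finset.sum_congr rfl fun (j : ℕ) _ ↦
    show _ = -h (2 * r - 2 - 2 * (j + 2 : ℕ)) - -h (2 * r - 2 - 2 * j) by
      push_cast
      ring_nf, sum_range_add_two_sub fun j ↦ -h (2 * r - 2 - 2 * j)]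
  push_cast
  ring_nf

/-- The highest root is `2 ε_0`, so only the row `0` moves. The doubled values there have gaps `1`
while the shift is `2`, whence a telescoping with step two. -/
theorem sum_pairs_shift_C (h : ℤ → ℤ) (m : ℕ) (s r : ℤ) :
    ∑ x : Pairs (m + 1), (h ((if (x.2 : ℕ) = 0 then 2 else 0) +
      s * (if (x.1 : ℕ) = 0 then 2 else 0) +
        ((r - (x.2 : ℕ)) + s * (r - (x.1 : ℕ)))) -
        h ((r - (x.2 : ℕ)) + s * (r - (x.1 : ℕ)))) =
      ∑ j ∈ Finset.range m,
        (h (r + 2 + s * (r - (j + 1))) - h (r + s * (r - (j + 1)))) := by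
  rw [Pairs.sum_eq fun i j ↦ h ((if i = 0 then 2 else 0) +
      s * (if j = 0 then 2 else 0) +
        ((r - (i : ℕ)) + s * (r - (j : ℕ)))) -
        h ((r - (i : ℕ)) + s * (r - (j : ℕ))), sum_pairs_eq_of_one_row]
  · refine Finset.sum_congr rfl fun j _ ↦ ?_
    have h1 : ¬ j + 1 = 0 := by lia
    simp only [h1, if_false, if_true]
    push_cast
    ring_nf
  · intro i j hij
    have h1 : ¬ i + 1 = 0 := by lia
    have h2 : ¬ j = 0 := by lia
    simp only [h1, h2, if_false, mul_zero, zero_add, sub_self]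

theorem sum_pairs_shift_C_sub (h : ℤ → ℤ) (m : ℕ) (r : ℤ) :
    ∑ x : Pairs (m + 1), (h ((if (x.2 : ℕ) = 0 then 2 else 0) - (if (x.1 : ℕ) = 0 then 2 else 0) +
        ((r - (x.2 : ℕ)) - (r - (x.1 : ℕ)))) -
        h ((r - (x.2 : ℕ)) - (r - (x.1 : ℕ)))) =
      h (m + 2) + h (m + 1) - (h 2 + h 1) := by
  have h1 := sum_pairs_shift_C h m (-1) r
  simp only [neg_mul, one_mul, ← sub_eq_add_neg] at h1
  rw [h1, Finset.sum_congr rfl fun (j : ℕ) _ ↦ show _ = h ((j + 2 : ℕ) + 1) - h (j + 1) by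
    congr 2 <;> (push_cast; ring), sum_range_add_two_sub fun j ↦ h (j + 1)]
  push_cast
  ring_nf

theorem sum_pairs_shift_C_add (h : ℤ → ℤ) (m : ℕ) (r : ℤ) :
    ∑ x : Pairs (m + 1), (h ((if (x.2 : ℕ) = 0 then 2 else 0) + (if (x.1 : ℕ) = 0 then 2 else 0) +
        ((r - (x.2 : ℕ)) + (r - (x.1 : ℕ)))) -
        h ((r - (x.2 : ℕ)) + (r - (x.1 : ℕ)))) =
      h (2 * r) + h (2 * r + 1) - (h (2 * r - m) + h (2 * r + 1 - m)) := by
  have h1 := sum_pairs_shift_C h m 1 r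
  simp only [one_mul] at h1
  rw [h1, Finset.sum_congr rfl fun (j : ℕ) _ ↦
    show _ = -h (2 * r + 1 - (j + 2 : ℕ)) - -h (2 * r + 1 - j) by
      push_cast
      ring_nf, sum_range_add_two_sub fun j ↦ -h (2 * r + 1 - j)]
  push_cast
  ring_nf

end Sums

/-! ### Type `A`. -/

/-- The model of the root system of type `A`, with the positive roots `ε_i - ε_j`. -/
noncomputable def modelA (m : ℕ) : PositiveRootModel (CartanMatrix.A (m + 1)) (ℕ →₀ ℂ)
    (Pairs (m + 2)) 2 ((m + 1 : ℕ) + 1) where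
  vec := subVec
  vec_injective := subVec_injective
  simple k := Pairs.mk k (k + 1) (by lia) (by lia)
  coroot k := adjCoroot k
  coroot_simple i j := by
    simp only [subVec, adjCoroot, map_sub, coordForm_coordVec, CartanMatrix.A, Matrix.of_apply,
      Fin.ext_iff]
    split_ifs <;> first | (exfalso; lia) | norm_num
  exists_reflection k x hx := exists_subVec_eq_adjSwap (by lia) x hx
  induction_reflection Q h1 h2 := by
    refine Pairs.induction_up (fun k hk ↦ h1 ⟨k, by lia⟩) fun i j hij hj ↦
      h2 ⟨j, by lia⟩ _ _ (fun he ↦ ?_) (subVec_succ_right hij hj)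
    exact hij.ne (Pairs.ext_iff.mp he).1
  top := Pairs.mk 0 (m + 1) (by lia) (by lia)
  eq_top := by
    rintro ⟨⟨j, hj⟩, ⟨i, hi⟩⟩ h
    simp only at hi
    rw [Pairs.ext_iff]
    by_contra! hne
    simp only at hne
    by_cases h0 : i = 0
    · refine h ⟨j, by lia⟩ (Pairs.mk i (j + 1) (by lia) (by lia)) ?_
      simp only [subVec]
      module
    · refine h ⟨i - 1, by lia⟩ (Pairs.mk (i - 1) j (by lia) hj) ?_
      simp only [subVec, Nat.sub_add_cancel (Nat.pos_of_ne_zero h0)]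
      module
  halfSq _ := 1
  halfSq_unique g hg := by
    obtain ⟨k, hk⟩ := exists_eq_mul_of_pred (fun _ ↦ 1) one_ne_zero (fun i j hij ↦ by
      simp only [CartanMatrix.A, Matrix.of_apply, Fin.ext_iff]
      grind) g hg
    exact ⟨k, fun i ↦ by rw [hk, Int.cast_one]⟩
  -- The half-sum is altered by a multiple of the sum of the coordinates, which vanishes on the
  -- roots.
  rhoForm := coordForm fun i ↦ -i
  rhoForm_simple i := by simp [subVec]
  rhoForm_ne_zero := by
    rintro ⟨⟨j, hj⟩, ⟨i, hi⟩⟩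
    simp only [subVec, map_sub, coordForm_coordVec]
    rw [neg_sub_neg, sub_ne_zero]
    exact Nat.cast_injective.ne hi.ne'
  rhoForm_top := by
    simp only [subVec, map_sub, coordForm_coordVec]
    push_cast
    ring
  topForm := coordForm fun i ↦ (if i = 0 then 1 else 0) - (if i = m + 1 then 1 else 0)
  topForm_simple i := by
    simp only [subVec, adjCoroot, map_sub, coordForm_coordVec]
    split_ifs <;> first | (exfalso; lia) | norm_num
  topForm_top := by
    simp only [subVec, map_sub, coordForm_coordVec]
    norm_num
  shift := by
    -- Because `β = 2`, the number `γ/2 = β + γ/2 - 2` occurs on both sides: it is the doubled value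
    -- `m + 2`, which cancels.
    refine multiset_map_add_eq_of_sum_half (fun x ↦ (if (x.2 : ℕ) = 0 then 2 else 0) +
      (if (x.1 : ℕ) = m + 1 then 2 else 0) + (2 * (x.1 : ℕ) - 2 * (x.2 : ℕ)))
      (fun x ↦ 2 * (x.1 : ℕ) - 2 * (x.2 : ℕ)) 2 2 (m + 2) (2 * m + 6) (2 * m + 2) (m + 2)
      ?_ ?_ ?_ ?_ ?_ ?_ ?_ ?_ fun f ↦ ?_
    · rintro ⟨⟨j, hj⟩, ⟨i, hi⟩⟩
      simp only at hi
      have h1 : ¬ j = 0 := by lia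
      have h2 : ¬ i = m + 1 := by lia
      simp only [subVec, map_sub, coordForm_coordVec, h1, h2, if_false]
      push_cast
      split_ifs <;> ring
    · intro x
      simp only [subVec, map_sub, coordForm_coordVec]
      push_cast
      ring
    · norm_num
    · norm_num
    · push_cast; ring
    · push_cast; ring
    · push_cast; ring
    · push_cast; ring
    · rw [sum_shift_A]
      ring

/-! ### Types `B` and `C`, with `c = 1` and `c = 2` respectively. -/

section SingleVectors

variable {N : ℕ} {c : ℂ}

/-- The vectors `ε_i - ε_j`, `ε_i + ε_j` and `c ε_i`. -/
noncomputable def vecBC (c : ℂ) : Pairs N ⊕ Pairs N ⊕ Fin N → (ℕ →₀ ℂ) :=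
  Sum.elim subVec (Sum.elim addVec fun i ↦ c • coordVec i)

/-- The indices of the vectors `ε_k - ε_{k+1}` and of the last multiple of a coordinate vector. -/
def simpleBC (k : Fin N) : Pairs N ⊕ Pairs N ⊕ Fin N :=
  if h : k + 1 < N then Sum.inl (Pairs.mk k (k + 1) (by lia) h) else Sum.inr (Sum.inr k)

/-- The coroots of the vectors with the indices `simpleBC k`. -/
noncomputable def corootBC (c : ℂ) (k : Fin N) : (ℕ →₀ ℂ) →ₗ[ℂ] ℂ :=
  if (k : ℕ) + 1 < N then adjCoroot k else coordForm fun i ↦ if i = k then 2 / c else 0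

theorem simpleBC_of_lt {k : ℕ} (h : k + 1 < N) :
    simpleBC (⟨k, by lia⟩ : Fin N) = Sum.inl (Pairs.mk k (k + 1) (by lia) h) := dif_pos h

theorem simpleBC_last : simpleBC ⟨N, by lia⟩ = Sum.inr (Sum.inr (⟨N, by lia⟩ : Fin (N + 1))) :=
  dif_neg (lt_irrefl _)

theorem vecBC_simpleBC_of_lt {k : ℕ} (h : k + 1 < N) :
    vecBC c (simpleBC (⟨k, by lia⟩ : Fin N)) = subVec (Pairs.mk k (k + 1) (by lia) h) := by
  rw [simpleBC_of_lt h]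
  rfl

theorem vecBC_simpleBC_last : vecBC c (simpleBC (⟨N, by lia⟩ : Fin (N + 1))) = c • coordVec N := by
  rw [simpleBC_last]
  rfl

theorem corootBC_of_lt {k : ℕ} (h : k + 1 < N) : corootBC c (⟨k, by lia⟩ : Fin N) = adjCoroot k :=
  if_pos h

theorem corootBC_last : corootBC c (⟨N, by lia⟩ : Fin (N + 1)) =
    coordForm fun i ↦ if i = N then 2 / c else 0 :=
  if_neg (lt_irrefl _)

theorem lt_or_last_induction {Q : Fin (N + 1) → Prop}
    (h1 : ∀ k (hk : k + 1 < N + 1), Q ⟨k, by lia⟩) (h2 : Q ⟨N, by lia⟩) (k : Fin (N + 1)) : Q k := by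
  obtain ⟨k, hk⟩ := k
  rcases Nat.lt_succ_iff_lt_or_eq.mp hk with h | rfl
  · exact h1 k (by lia)
  · exact h2

theorem addVec_ne_subVec (x y : Pairs N) : addVec x ≠ subVec y := by
  intro h
  have := congrArg (coordForm fun _ ↦ 1) h
  simp only [addVec, subVec, map_add, map_sub, coordForm_coordVec] at this
  norm_num at this

theorem vecBC_injective (hc : c ≠ 0) : Function.Injective (vecBC (N := N) c) := by
  -- The sum of the coordinates is `c` on the left and `0` on the right.
  have h1 : ∀ (i : ℕ) (y : Pairs N), c • coordVec i ≠ subVec y := fun i y h ↦ by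
    have := congrArg (coordForm fun _ ↦ 1) h
    simp only [subVec, map_sub, map_smul, coordForm_coordVec] at this
    exact hc (by simpa using this)
  have h2 : ∀ (i : ℕ) (y : Pairs N), c • coordVec i ≠ addVec y := by
    rintro i ⟨⟨j', hj'⟩, ⟨i', hi'⟩⟩ h
    simp only at hi'
    have h3 := DFunLike.congr_fun h i'
    have h4 := DFunLike.congr_fun h j'
    simp only [addVec, Finsupp.add_apply, Finsupp.smul_apply, coordVec_apply] at h3 h4
    split_ifs at h3 h4 <;> first | lia | (norm_num at h3; done) | norm_num at h4
  rintro (x | x | x) (y | y | y) h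
  · rw [subVec_injective h]
  · exact (addVec_ne_subVec y x h.symm).elim
  · exact (h1 y x h.symm).elim
  · exact (addVec_ne_subVec x y h).elim
  · rw [addVec_injective h]
  · exact (h2 y x h.symm).elim
  · exact (h1 x y h).elim
  · exact (h2 x y h).elim
  · have h3 := smul_right_injective _ hc (show c • coordVec x = c • coordVec y from h)
    rw [Fin.ext (Finsupp.single_left_injective one_ne_zero h3)]

/-- The last simple reflection changes the sign of the last coordinate: it exchanges `ε_i - ε_N`
with `ε_i + ε_N` and fixes every other vector except its own root. The remaining reflections are
transpositions. -/
theorem exists_vecBC_eq_reflection (hc : c ≠ 0) (k : Fin (N + 1))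
    (x : Pairs (N + 1) ⊕ Pairs (N + 1) ⊕ Fin (N + 1)) (hx : x ≠ simpleBC k) :
    ∃ y : Pairs (N + 1) ⊕ Pairs (N + 1) ⊕ Fin (N + 1),
      vecBC c y = vecBC c x - corootBC c k (vecBC c x) • vecBC c (simpleBC k) := by
  induction k using lt_or_last_induction with
  | h1 k hk =>
    rw [vecBC_simpleBC_of_lt hk, corootBC_of_lt hk]
    rw [simpleBC_of_lt hk] at hx
    rcases x with x | x | x
    · obtain ⟨y, hy⟩ := exists_subVec_eq_adjSwap hk x fun h ↦ hx (congrArg Sum.inl h)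
      exact ⟨Sum.inl y, hy⟩
    · obtain ⟨y, hy⟩ := exists_addVec_eq_adjSwap hk x
      exact ⟨Sum.inr (Sum.inl y), hy⟩
    · refine ⟨Sum.inr (Sum.inr ⟨adjSwap k x, by unfold adjSwap; split_ifs <;> lia⟩), ?_⟩
      simp only [vecBC, Sum.elim_inr, coordVec_adjSwap, map_smul, subVec]
      module
  | h2 =>
    rw [vecBC_simpleBC_last, corootBC_last]
    rw [simpleBC_last] at hx
    rcases x with x | x | x
    · obtain ⟨⟨j, hj⟩, ⟨i, hi⟩⟩ := x
      simp only at hi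
      have h1 : ¬ i = N := by lia
      by_cases h2 : j = N
      · refine ⟨Sum.inr (Sum.inl ⟨⟨j, hj⟩, ⟨i, hi⟩⟩), ?_⟩
        simp only [vecBC, Sum.elim_inr, Sum.elim_inl, subVec, addVec, map_sub, coordForm_coordVec,
          h1, h2, if_true, if_false]
        rw [zero_sub, smul_smul, neg_mul, div_mul_cancel₀ _ hc]
        module
      · refine ⟨Sum.inl ⟨⟨j, hj⟩, ⟨i, hi⟩⟩, ?_⟩
        simp only [vecBC, Sum.elim_inl, subVec, map_sub, coordForm_coordVec, h1, h2, if_false]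
        module
    · obtain ⟨⟨j, hj⟩, ⟨i, hi⟩⟩ := x
      simp only at hi
      have h1 : ¬ i = N := by lia
      by_cases h2 : j = N
      · refine ⟨Sum.inl ⟨⟨j, hj⟩, ⟨i, hi⟩⟩, ?_⟩
        simp only [vecBC, Sum.elim_inr, Sum.elim_inl, subVec, addVec, map_add, coordForm_coordVec,
          h1, h2, if_true, if_false]
        rw [zero_add, smul_smul, div_mul_cancel₀ _ hc]
        module
      · refine ⟨Sum.inr (Sum.inl ⟨⟨j, hj⟩, ⟨i, hi⟩⟩), ?_⟩
        simp only [vecBC, Sum.elim_inl, Sum.elim_inr, addVec, map_add, coordForm_coordVec, h1, h2,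
          if_false]
        module
    · have h1 : ¬ (x : ℕ) = N := fun h ↦ hx (by rw [show x = ⟨N, by lia⟩ from Fin.ext h])
      refine ⟨Sum.inr (Sum.inr x), ?_⟩
      simp only [vecBC, Sum.elim_inr, map_smul, coordForm_coordVec, h1, if_false]
      module

/-- The differences come from the simple ones by transpositions; the last reflection turns `ε_i -
ε_N` into `ε_i + ε_N`, from which transpositions give all sums. The multiples of coordinate vectors
descend from the last one. -/
theorem vecBC_induction (hc : c ≠ 0) (Q : Pairs (N + 1) ⊕ Pairs (N + 1) ⊕ Fin (N + 1) → Prop)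
    (h1 : ∀ k, Q (simpleBC k))
    (h2 : ∀ k x y, x ≠ simpleBC k →
      vecBC c y = vecBC c x - corootBC c k (vecBC c x) • vecBC c (simpleBC k) → Q x → Q y)
    (x : Pairs (N + 1) ⊕ Pairs (N + 1) ⊕ Fin (N + 1)) : Q x := by
  have hsub : ∀ x, Q (Sum.inl x) := by
    refine Pairs.induction_up (fun k hk ↦ ?_) fun i j hij hj ↦ ?_
    · rw [← simpleBC_of_lt hk]
      exact h1 _
    · refine h2 ⟨j, by lia⟩ _ _ ?_ ?_
      · rw [simpleBC_of_lt hj]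
        exact fun he ↦ hij.ne (Pairs.ext_iff.mp (Sum.inl_injective he)).1
      · rw [vecBC_simpleBC_of_lt hj, corootBC_of_lt hj]
        exact subVec_succ_right hij hj
  have hadd : ∀ x, Q (Sum.inr (Sum.inl x)) := by
    refine Pairs.induction_down (fun i hi ↦ ?_) fun i j hij hj ↦ ?_
    · refine h2 ⟨N, by lia⟩ _ _ ?_ ?_ (hsub (Pairs.mk i N hi (by lia)))
      · rw [simpleBC_last]
        exact Sum.inl_ne_inr
      · have h3 : ¬ i = N := by lia
        rw [vecBC_simpleBC_last, corootBC_last]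
        simp only [vecBC, Sum.elim_inr, Sum.elim_inl, subVec, addVec, map_sub, coordForm_coordVec,
          h3, if_true, if_false]
        rw [zero_sub, smul_smul, neg_mul, div_mul_cancel₀ _ hc]
        module
    · have hj' : j + 1 < N + 1 := by lia
      refine h2 ⟨j, by lia⟩ _ _ ?_ ?_
      · rw [simpleBC_of_lt hj']
        exact Sum.inr_ne_inl
      · rw [vecBC_simpleBC_of_lt hj', corootBC_of_lt hj']
        exact addVec_pred_right hij hj'
  have hsingle : ∀ k i (hi : i < N + 1), i + k = N → Q (Sum.inr (Sum.inr ⟨i, hi⟩)) := by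
    intro k
    induction k with
    | zero =>
      rintro i hi rfl
      rw [← simpleBC_last]
      exact h1 _
    | succ k ih =>
      intro i hi hk
      have hi' : i + 1 < N + 1 := by lia
      refine h2 ⟨i, hi⟩ _ _ ?_ ?_ (ih (i + 1) (by lia) (by lia))
      · rw [simpleBC_of_lt hi']
        exact Sum.inr_ne_inl
      · rw [vecBC_simpleBC_of_lt hi', corootBC_of_lt hi']
        simp only [vecBC, Sum.elim_inr, subVec, adjCoroot, map_smul, coordForm_coordVec,
          Nat.add_eq_left, one_ne_zero, if_true, if_false]
        module
  rcases x with x | x | x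
  · exact hsub x
  · exact hadd x
  · exact hsingle (N - x) x x.2 (by lia)

end SingleVectors

theorem coroot_simpleBC {m : ℕ} {c : ℂ} (hc : c ≠ 0) (i j : Fin (m + 1)) :
    corootBC c j (vecBC c (simpleBC i)) =
      if i = j then 2 else if (i : ℕ) + 1 = j then (if (j : ℕ) = m then -2 / c else -1)
      else if (j : ℕ) + 1 = i then (if (i : ℕ) = m then -c else -1) else 0 := by
  simp only [Fin.ext_iff]
  induction i using lt_or_last_induction with
  | h1 i hi =>
    rw [vecBC_simpleBC_of_lt hi]
    induction j using lt_or_last_induction with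
    | h1 j hj =>
      rw [corootBC_of_lt hj]
      simp only [subVec, adjCoroot, map_sub, coordForm_coordVec]
      split_ifs <;> first | (exfalso; lia) | norm_num
    | h2 =>
      rw [corootBC_last]
      simp only [subVec, map_sub, coordForm_coordVec]
      split_ifs <;> first | (exfalso; lia) | ring
  | h2 =>
    rw [vecBC_simpleBC_last]
    induction j using lt_or_last_induction with
    | h1 j hj =>
      rw [corootBC_of_lt hj]
      simp only [adjCoroot, map_smul, coordForm_coordVec, smul_eq_mul]
      split_ifs <;> first | (exfalso; lia) | ring
    | h2 =>
      rw [corootBC_last]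
      simp only [map_smul, coordForm_coordVec, if_true, smul_eq_mul]
      field_simp

/-- The model of the root system of type `B`, with the positive roots `ε_i ± ε_j` and `ε_i`. -/
noncomputable def modelB (m : ℕ) : PositiveRootModel (CartanMatrix.B (m + 2)) (ℕ →₀ ℂ)
    (Pairs (m + 2) ⊕ Pairs (m + 2) ⊕ Fin (m + 2)) 4 (2 * (m + 2 : ℕ) - 3) where
  vec := vecBC 1
  vec_injective := vecBC_injective one_ne_zero
  simple := simpleBC
  coroot := corootBC 1
  coroot_simple i j := by
    rw [coroot_simpleBC one_ne_zero]
    simp only [CartanMatrix.B, Matrix.of_apply]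
    split_ifs <;> first | (exfalso; lia) | norm_num
  exists_reflection := exists_vecBC_eq_reflection one_ne_zero
  induction_reflection := vecBC_induction one_ne_zero
  top := Sum.inr (Sum.inl (Pairs.mk 0 1 (by lia) (by lia)))
  eq_top := by
    have hstep : ∀ (k : ℕ) (hk : k + 1 < m + 2),
      vecBC 1 (simpleBC (⟨k, by lia⟩ : Fin (m + 2))) = coordVec k - coordVec (k + 1) :=
      fun k hk ↦ vecBC_simpleBC_of_lt hk
    rintro (⟨⟨j, hj⟩, ⟨i, hi⟩⟩ | ⟨⟨j, hj⟩, ⟨i, hi⟩⟩ | ⟨i, hi⟩) h <;> try simp only at hi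
    · exfalso
      by_cases h0 : j < m + 1
      · refine h ⟨j, by lia⟩ (Sum.inl (Pairs.mk i (j + 1) (by lia) (by lia))) ?_
        rw [hstep j (by lia)]
        simp only [vecBC, Sum.elim_inl, subVec]
        module
      · obtain rfl : j = m + 1 := by lia
        refine h ⟨m + 1, by lia⟩ (Sum.inr (Sum.inr ⟨i, by lia⟩)) ?_
        rw [vecBC_simpleBC_last]
        simp only [vecBC, Sum.elim_inl, Sum.elim_inr, subVec]
        module
    · by_cases h0 : i = 0
      · by_cases h1 : j = 1
        · exact congrArg (Sum.inr ∘ Sum.inl) (Pairs.ext_iff.mpr ⟨h0, h1⟩)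
        · refine (h ⟨j - 1, by lia⟩
            (Sum.inr (Sum.inl (Pairs.mk i (j - 1) (by lia) (by lia)))) ?_).elim
          rw [hstep (j - 1) (by lia), Nat.sub_add_cancel (by lia)]
          simp only [vecBC, Sum.elim_inl, Sum.elim_inr, addVec]
          module
      · refine (h ⟨i - 1, by lia⟩
          (Sum.inr (Sum.inl (Pairs.mk (i - 1) j (by lia) (by lia)))) ?_).elim
        rw [hstep (i - 1) (by lia), Nat.sub_add_cancel (by lia)]
        simp only [vecBC, Sum.elim_inl, Sum.elim_inr, addVec]
        module
    · exfalso
      by_cases h0 : i < m + 1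
      · refine h ⟨m + 1, by lia⟩
          (Sum.inr (Sum.inl (Pairs.mk i (m + 1) (by lia) (by lia)))) ?_
        rw [vecBC_simpleBC_last]
        simp only [vecBC, Sum.elim_inl, Sum.elim_inr, addVec]
        module
      · obtain rfl : i = m + 1 := by lia
        refine h ⟨m, by lia⟩ (Sum.inr (Sum.inr ⟨m, by lia⟩)) ?_
        rw [hstep m (by lia)]
        simp only [vecBC, Sum.elim_inr]
        module
  halfSq i := if (i : ℕ) = m + 1 then 1 / 2 else 1
  halfSq_unique g hg := by
    obtain ⟨k, hk⟩ := exists_eq_mul_of_pred (fun i ↦ if (i : ℕ) = m + 1 then 1 else 2)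
      (by simp) (fun i j hij ↦ by
        simp only [CartanMatrix.B, Matrix.of_apply, Fin.ext_iff]
        grind) g hg
    refine ⟨2 * k, fun i ↦ ?_⟩
    rw [hk]
    split_ifs <;> (push_cast; ring)
  -- With `n = m + 2`, the half-sum has the coordinates `n - 1/2 - i`, counted from `i = 0`.
  rhoForm := coordForm fun i ↦ (2 * m + 3 - 2 * i) / 2
  rhoForm_simple i := by
    induction i using lt_or_last_induction with
    | h1 i hi =>
      rw [vecBC_simpleBC_of_lt hi, if_neg (by simp only; lia)]
      simp only [subVec, map_sub, coordForm_coordVec]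
      push_cast
      ring
    | h2 =>
      rw [vecBC_simpleBC_last, if_pos rfl]
      simp only [map_smul, coordForm_coordVec]
      push_cast
      ring_nf
  rhoForm_ne_zero := by
    rintro (⟨⟨j, hj⟩, ⟨i, hi⟩⟩ | ⟨⟨j, hj⟩, ⟨i, hi⟩⟩ | ⟨i, hi⟩) h <;> (try simp only at hi) <;>
      simp only [vecBC, Sum.elim_inl, Sum.elim_inr, subVec, addVec, map_sub, map_add, one_smul,
        coordForm_coordVec] at h
    · have : ((j : ℤ) : ℂ) = (i : ℤ) := by push_cast; linear_combination h
      have := Int.cast_injective this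
      lia
    · have : ((2 * m + 3 : ℤ) : ℂ) = (i + j : ℤ) := by push_cast; linear_combination h
      have := Int.cast_injective this
      lia
    -- Excluded by parity; the preceding case is excluded by size.
    · have : ((2 * m + 3 : ℤ) : ℂ) = (2 * i : ℤ) := by push_cast; linear_combination 2 * h
      have := Int.cast_injective this
      lia
  rhoForm_top := by
    simp only [vecBC, Sum.elim_inl, Sum.elim_inr, addVec, map_add, coordForm_coordVec]
    push_cast
    ring
  topForm := coordForm fun i ↦ if i < 2 then 1 else 0
  topForm_simple i := by
    induction i using lt_or_last_induction with
    | h1 i hi =>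
      rw [vecBC_simpleBC_of_lt hi, corootBC_of_lt hi, if_neg (by simp only; lia)]
      simp only [vecBC, Sum.elim_inl, Sum.elim_inr, subVec, addVec, map_sub, map_add, adjCoroot,
        coordForm_coordVec]
      split_ifs <;> first | (exfalso; lia) | norm_num
    | h2 =>
      rw [vecBC_simpleBC_last, corootBC_last, if_pos rfl]
      simp only [vecBC, Sum.elim_inl, Sum.elim_inr, addVec, map_smul, map_add, coordForm_coordVec]
      split_ifs <;> first | (exfalso; lia) | norm_num
  topForm_top := by
    simp only [vecBC, Sum.elim_inl, Sum.elim_inr, addVec, map_add, coordForm_coordVec]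
    norm_num
  shift := by
    let r : ℤ := 2 * m + 3
    let δ : ℕ → ℤ := fun i ↦ if i < 2 then 2 else 0
    refine multiset_map_add_eq_of_sum_half
      (Sum.elim (fun x : Pairs (m + 2) ↦ δ x.2 - δ x.1 + ((r - 2 * (x.2 : ℕ)) - (r - 2 * (x.1 : ℕ))))
        (Sum.elim (fun x : Pairs (m + 2) ↦ δ x.2 + δ x.1 + ((r - 2 * (x.2 : ℕ)) + (r - 2 * (x.1 : ℕ))))
          fun x : Fin (m + 2) ↦ δ x + (r - 2 * (x : ℕ))))
      (Sum.elim (fun x : Pairs (m + 2) ↦ (r - 2 * (x.2 : ℕ)) - (r - 2 * (x.1 : ℕ)))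
        (Sum.elim (fun x : Pairs (m + 2) ↦ (r - 2 * (x.2 : ℕ)) + (r - 2 * (x.1 : ℕ)))
          fun x : Fin (m + 2) ↦ r - 2 * (x : ℕ)))
      2 4 (2 * m + 1) (4 * m + 8) (4 * m + 2) (2 * m + 5) ?_ ?_ ?_ ?_ ?_ ?_ ?_ ?_ fun f ↦ ?_
    · have hδ : ∀ i, (if i < 2 then 1 else 0 : ℂ) = (δ i : ℂ) / 2 := fun i ↦ by
        simp only [δ]
        split_ifs <;> norm_num
      rintro (x | x | x) <;>
        simp only [vecBC, Sum.elim_inl, Sum.elim_inr, subVec, addVec, map_sub, map_add, one_smul,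
          coordForm_coordVec, hδ, r] <;>
        (push_cast; ring)
    · rintro (x | x | x) <;>
        simp only [vecBC, Sum.elim_inl, Sum.elim_inr, subVec, addVec, map_sub, map_add, one_smul,
          coordForm_coordVec, r] <;>
        (push_cast; ring)
    · norm_num
    · norm_num
    · push_cast; ring
    · push_cast; ring
    · push_cast; ring
    · push_cast; ring
    · rw [Fintype.sum_sum_type, Fintype.sum_sum_type]
      simp only [Sum.elim_inl, Sum.elim_inr, δ]
      rw [sum_pairs_shift_sub, sum_pairs_shift_add,
        Fin.sum_univ_eq_sum_range fun x ↦ f ((if x < 2 then 2 else 0) + (r - 2 * (x : ℕ))) -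
          f (r - 2 * (x : ℕ)), Finset.sum_range_succ', Finset.sum_range_succ',
        Finset.sum_eq_zero fun i _ ↦ by
          rw [if_neg (by lia), zero_add, sub_self]]
      simp only [r]
      push_cast
      ring_nf

/-- The model of the root system of type `C`, with the positive roots `ε_i ± ε_j` and `2 ε_i`. -/
noncomputable def modelC (m : ℕ) : PositiveRootModel (CartanMatrix.C (m + 2)) (ℕ →₀ ℂ)
    (Pairs (m + 2) ⊕ Pairs (m + 2) ⊕ Fin (m + 2)) 1 ((m + 2 : ℕ) + 2) where
  vec := vecBC 2
  vec_injective := vecBC_injective two_ne_zero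
  simple := simpleBC
  coroot := corootBC 2
  coroot_simple i j := by
    rw [coroot_simpleBC two_ne_zero]
    simp only [CartanMatrix.C, Matrix.of_apply]
    split_ifs <;> first | (exfalso; lia) | norm_num
  exists_reflection := exists_vecBC_eq_reflection two_ne_zero
  induction_reflection := vecBC_induction two_ne_zero
  top := Sum.inr (Sum.inr ⟨0, by lia⟩)
  eq_top := by
    have hstep : ∀ (k : ℕ) (hk : k + 1 < m + 2),
      vecBC 2 (simpleBC (⟨k, by lia⟩ : Fin (m + 2))) = coordVec k - coordVec (k + 1) :=
      fun k hk ↦ vecBC_simpleBC_of_lt hk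
    rintro (⟨⟨j, hj⟩, ⟨i, hi⟩⟩ | ⟨⟨j, hj⟩, ⟨i, hi⟩⟩ | ⟨i, hi⟩) h <;> try simp only at hi
    · exfalso
      by_cases h0 : j < m + 1
      · refine h ⟨j, by lia⟩ (Sum.inl (Pairs.mk i (j + 1) (by lia) (by lia))) ?_
        rw [hstep j (by lia)]
        simp only [vecBC, Sum.elim_inl, subVec]
        module
      · obtain rfl : j = m + 1 := by lia
        refine h ⟨m + 1, by lia⟩ (Sum.inr (Sum.inl (Pairs.mk i (m + 1) hi (by lia)))) ?_
        rw [vecBC_simpleBC_last]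
        simp only [vecBC, Sum.elim_inl, Sum.elim_inr, subVec, addVec]
        module
    · exfalso
      by_cases h0 : i + 1 = j
      · subst h0
        refine h ⟨i, by lia⟩ (Sum.inr (Sum.inr ⟨i, by lia⟩)) ?_
        rw [hstep i (by lia)]
        simp only [vecBC, Sum.elim_inl, Sum.elim_inr, addVec]
        module
      · refine h ⟨j - 1, by lia⟩
          (Sum.inr (Sum.inl (Pairs.mk i (j - 1) (by lia) (by lia)))) ?_
        rw [hstep (j - 1) (by lia), Nat.sub_add_cancel (by lia)]
        simp only [vecBC, Sum.elim_inl, Sum.elim_inr, addVec]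
        module
    · by_cases h0 : i = 0
      · exact congrArg (Sum.inr ∘ Sum.inr) (Fin.ext h0)
      · refine (h ⟨i - 1, by lia⟩
          (Sum.inr (Sum.inl (Pairs.mk (i - 1) i (by lia) (by lia)))) ?_).elim
        rw [hstep (i - 1) (by lia), Nat.sub_add_cancel (by lia)]
        simp only [vecBC, Sum.elim_inr, Sum.elim_inl, addVec]
        module
  halfSq i := if (i : ℕ) = m + 1 then 1 else 1 / 2
  halfSq_unique g hg := by
    obtain ⟨k, hk⟩ := exists_eq_mul_of_pred (fun i ↦ if (i : ℕ) = m + 1 then 2 else 1)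
      (by simp) (fun i j hij ↦ by
        simp only [CartanMatrix.C, Matrix.of_apply, Fin.ext_iff]
        grind) g hg
    refine ⟨2 * k, fun i ↦ ?_⟩
    rw [hk]
    split_ifs <;> (push_cast; ring)
  -- The long roots `2 ε_i` have square `2`, so `(ε_i, ε_i) = 1/2`; this halves the coordinates `n -
  -- i` of the half-sum, where `n = m + 2`.
  rhoForm := coordForm fun i ↦ (m + 2 - i) / 2
  rhoForm_simple i := by
    induction i using lt_or_last_induction with
    | h1 i hi =>
      rw [vecBC_simpleBC_of_lt hi, if_neg (by simp only; lia)]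
      simp only [subVec, map_sub, coordForm_coordVec]
      push_cast
      ring
    | h2 =>
      rw [vecBC_simpleBC_last, if_pos rfl]
      simp only [map_smul, coordForm_coordVec]
      push_cast
      ring_nf
  rhoForm_ne_zero := by
    rintro (⟨⟨j, hj⟩, ⟨i, hi⟩⟩ | ⟨⟨j, hj⟩, ⟨i, hi⟩⟩ | ⟨i, hi⟩) h <;> (try simp only at hi) <;>
      simp only [vecBC, Sum.elim_inl, Sum.elim_inr, subVec, addVec, map_sub, map_add, map_smul, smul_eq_mul,
        coordForm_coordVec] at h
    · have : ((j : ℤ) : ℂ) = (i : ℤ) := by push_cast; linear_combination 2 * h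
      have := Int.cast_injective this
      lia
    · have : ((2 * m + 4 : ℤ) : ℂ) = (i + j : ℤ) := by push_cast; linear_combination 2 * h
      have := Int.cast_injective this
      lia
    · have : ((m + 2 : ℤ) : ℂ) = (i : ℤ) := by push_cast; linear_combination h
      have := Int.cast_injective this
      lia
  rhoForm_top := by
    simp only [vecBC, Sum.elim_inr, map_smul, coordForm_coordVec, smul_eq_mul]
    push_cast
    ring
  topForm := coordForm fun i ↦ if i = 0 then 1 else 0
  topForm_simple i := by
    induction i using lt_or_last_induction with
    | h1 i hi =>
      rw [vecBC_simpleBC_of_lt hi, corootBC_of_lt hi, if_neg (by simp only; lia)]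
      simp only [vecBC, Sum.elim_inr, subVec, map_sub, map_smul, smul_eq_mul, adjCoroot,
        coordForm_coordVec]
      split_ifs <;> first | (exfalso; lia) | norm_num
    | h2 =>
      rw [vecBC_simpleBC_last, corootBC_last, if_pos rfl]
      simp only [vecBC, Sum.elim_inr, map_smul, coordForm_coordVec, smul_eq_mul]
      split_ifs <;> first | (exfalso; lia) | norm_num
  topForm_top := by
    simp only [vecBC, Sum.elim_inr, map_smul, coordForm_coordVec]
    norm_num
  shift := by
    let r : ℤ := m + 2
    let δ : ℕ → ℤ := fun i ↦ if i = 0 then 2 else 0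
    refine multiset_map_add_eq_of_sum_half
      (Sum.elim (fun x : Pairs (m + 2) ↦ δ x.2 - δ x.1 + ((r - (x.2 : ℕ)) - (r - (x.1 : ℕ))))
        (Sum.elim
          (fun x : Pairs (m + 2) ↦ δ x.2 + δ x.1 + ((r - (x.2 : ℕ)) + (r - (x.1 : ℕ))))
          fun x : Fin (m + 2) ↦ 2 * (δ x + (r - (x : ℕ)))))
      (Sum.elim (fun x : Pairs (m + 2) ↦ (r - (x.2 : ℕ)) - (r - (x.1 : ℕ)))
        (Sum.elim (fun x : Pairs (m + 2) ↦ (r - (x.2 : ℕ)) + (r - (x.1 : ℕ)))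
          fun x : Fin (m + 2) ↦ 2 * (r - (x : ℕ))))
      2 1 (m + 4) (2 * m + 8) (2 * m + 5) (m + 2) ?_ ?_ ?_ ?_ ?_ ?_ ?_ ?_ fun f ↦ ?_
    · have hδ : ∀ i, (if i = 0 then 1 else 0 : ℂ) = (δ i : ℂ) / 2 := fun i ↦ by
        simp only [δ]
        split_ifs <;> norm_num
      rintro (x | x | x) <;>
        simp only [vecBC, Sum.elim_inl, Sum.elim_inr, subVec, addVec, map_sub, map_add, map_smul, smul_eq_mul,
          coordForm_coordVec, hδ, r] <;>
        (push_cast; ring)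
    · rintro (x | x | x) <;>
        simp only [vecBC, Sum.elim_inl, Sum.elim_inr, subVec, addVec, map_sub, map_add, map_smul, smul_eq_mul,
          coordForm_coordVec, r] <;>
        (push_cast; ring)
    · norm_num
    · norm_num
    · push_cast; ring
    · push_cast; ring
    · push_cast; ring
    · push_cast; ring
    · rw [Fintype.sum_sum_type, Fintype.sum_sum_type]
      simp only [Sum.elim_inl, Sum.elim_inr, δ]
      rw [sum_pairs_shift_C_sub, sum_pairs_shift_C_add,
        Fin.sum_univ_eq_sum_range fun x ↦ f (2 * ((if x = 0 then 2 else 0) + (r - (x : ℕ)))) -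
          f (2 * (r - (x : ℕ))), Finset.sum_range_succ',
        Finset.sum_eq_zero fun i _ ↦ by
          rw [if_neg (by lia), zero_add, sub_self]]
      rw [if_pos rfl]
      simp only [r]
      push_cast
      ring_nf

/-! ### Type `D`. -/

section Pairs

variable {m : ℕ}

/-- The vectors `ε_i - ε_j` and `ε_i + ε_j`. -/
noncomputable def vecD : Pairs (m + 2) ⊕ Pairs (m + 2) → (ℕ →₀ ℂ) :=
  Sum.elim subVec addVec

/-- The indices of the vectors `ε_k - ε_{k+1}` and of the last vector `ε_i + ε_j`. -/
def simpleD (k : Fin (m + 2)) : Pairs (m + 2) ⊕ Pairs (m + 2) :=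
  if h : k + 1 < m + 2 then Sum.inl (Pairs.mk k (k + 1) (by lia) h)
  else Sum.inr (Pairs.mk m (m + 1) (by lia) (by lia))

/-- The coroots of the vectors with the indices `simpleD k`. -/
noncomputable def corootD (k : Fin (m + 2)) : (ℕ →₀ ℂ) →ₗ[ℂ] ℂ :=
  if (k : ℕ) + 1 < m + 2 then adjCoroot k
  else coordForm fun i ↦ if i = m ∨ i = m + 1 then 1 else 0

theorem simpleD_of_lt {k : ℕ} (h : k + 1 < m + 2) :
    simpleD (⟨k, by lia⟩ : Fin (m + 2)) = Sum.inl (Pairs.mk k (k + 1) (by lia) h) := dif_pos h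

theorem simpleD_last : simpleD (⟨m + 1, by lia⟩ : Fin (m + 2)) =
    Sum.inr (Pairs.mk m (m + 1) (by lia) (by lia)) :=
  dif_neg (lt_irrefl _)

theorem vecD_simpleD_of_lt {k : ℕ} (h : k + 1 < m + 2) :
    vecD (simpleD (⟨k, by lia⟩ : Fin (m + 2))) = subVec (Pairs.mk k (k + 1) (by lia) h) := by
  rw [simpleD_of_lt h]
  rfl

theorem vecD_simpleD_last :
    vecD (simpleD (⟨m + 1, by lia⟩ : Fin (m + 2))) = coordVec m + coordVec (m + 1) := by
  rw [simpleD_last]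
  rfl

theorem corootD_of_lt {k : ℕ} (h : k + 1 < m + 2) :
    corootD (⟨k, by lia⟩ : Fin (m + 2)) = adjCoroot k :=
  if_pos h

theorem corootD_last : corootD (⟨m + 1, by lia⟩ : Fin (m + 2)) =
    coordForm fun i ↦ if i = m ∨ i = m + 1 then 1 else 0 :=
  if_neg (lt_irrefl _)

theorem vecD_injective : Function.Injective (vecD (m := m)) := by
  rintro (x | x) (y | y) h
  · rw [subVec_injective h]
  · exact (addVec_ne_subVec y x h.symm).elim
  · exact (addVec_ne_subVec x y h).elim
  · rw [addVec_injective h]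

/-- The last simple reflection sends `ε_m` to `-ε_{m+1}` and `ε_{m+1}` to `-ε_m`. It fixes `ε_m -
ε_{m+1}`, and for `i < m` it exchanges `ε_i - ε_m` with `ε_i + ε_{m+1}` and `ε_i - ε_{m+1}` with
`ε_i + ε_m`. -/
theorem exists_vecD_eq_reflection (k : Fin (m + 2)) (x : Pairs (m + 2) ⊕ Pairs (m + 2))
    (hx : x ≠ simpleD k) : ∃ y : Pairs (m + 2) ⊕ Pairs (m + 2),
      vecD y = vecD x - corootD k (vecD x) • vecD (simpleD k) := by
  induction k using lt_or_last_induction with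
  | h1 k hk =>
    rw [vecD_simpleD_of_lt hk, corootD_of_lt hk]
    rw [simpleD_of_lt hk] at hx
    rcases x with x | x
    · obtain ⟨y, hy⟩ := exists_subVec_eq_adjSwap hk x fun h ↦ hx (congrArg Sum.inl h)
      exact ⟨Sum.inl y, hy⟩
    · obtain ⟨y, hy⟩ := exists_addVec_eq_adjSwap hk x
      exact ⟨Sum.inr y, hy⟩
  | h2 =>
    rw [vecD_simpleD_last, corootD_last]
    rw [simpleD_last] at hx
    rcases x with ⟨⟨j, hj⟩, ⟨i, hi⟩⟩ | ⟨⟨j, hj⟩, ⟨i, hi⟩⟩ <;> simp only at hi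
    · by_cases h1 : i = m
      · obtain rfl : j = m + 1 := by lia
        refine ⟨Sum.inl ⟨⟨m + 1, hj⟩, ⟨i, hi⟩⟩, ?_⟩
        simp only [vecD, Sum.elim_inl, subVec, map_sub, coordForm_coordVec, h1, true_or, or_true,
          if_true]
        module
      have h2 : ¬ i = m + 1 := by lia
      by_cases h3 : j = m
      · refine ⟨Sum.inr (Pairs.mk i (m + 1) (by lia) (by lia)), ?_⟩
        simp only [vecD, Sum.elim_inl, Sum.elim_inr, subVec, addVec, map_sub, coordForm_coordVec,
          h1, h2, h3, true_or, or_self, if_true, if_false]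
        module
      by_cases h4 : j = m + 1
      · refine ⟨Sum.inr (Pairs.mk i m (by lia) (by lia)), ?_⟩
        simp only [vecD, Sum.elim_inl, Sum.elim_inr, subVec, addVec, map_sub, coordForm_coordVec,
          h1, h2, h4, or_true, or_self, if_true, if_false]
        module
      · refine ⟨Sum.inl ⟨⟨j, hj⟩, ⟨i, hi⟩⟩, ?_⟩
        simp only [vecD, Sum.elim_inl, subVec, map_sub, coordForm_coordVec, h1, h2, h3, h4,
          or_self, if_false]
        module
    · by_cases h1 : i = m
      · exact (hx (congrArg Sum.inr (Pairs.ext_iff.mpr ⟨h1, by simp only; lia⟩))).elim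
      have h2 : ¬ i = m + 1 := by lia
      by_cases h3 : j = m
      · refine ⟨Sum.inl (Pairs.mk i (m + 1) (by lia) (by lia)), ?_⟩
        simp only [vecD, Sum.elim_inl, Sum.elim_inr, subVec, addVec, map_add, coordForm_coordVec,
          h1, h2, h3, true_or, or_self, if_true, if_false]
        module
      by_cases h4 : j = m + 1
      · refine ⟨Sum.inl (Pairs.mk i m (by lia) (by lia)), ?_⟩
        simp only [vecD, Sum.elim_inl, Sum.elim_inr, subVec, addVec, map_add, coordForm_coordVec,
          h1, h2, h4, or_true, or_self, if_true, if_false]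
        module
      · refine ⟨Sum.inr ⟨⟨j, hj⟩, ⟨i, hi⟩⟩, ?_⟩
        simp only [vecD, Sum.elim_inr, addVec, map_add, coordForm_coordVec, h1, h2, h3, h4,
          or_self, if_false]
        module

theorem vecD_induction (Q : Pairs (m + 2) ⊕ Pairs (m + 2) → Prop)
    (h1 : ∀ k, Q (simpleD k))
    (h2 : ∀ k x y, x ≠ simpleD k →
      vecD y = vecD x - corootD k (vecD x) • vecD (simpleD k) → Q x → Q y)
    (x : Pairs (m + 2) ⊕ Pairs (m + 2)) : Q x := by
  have hsub : ∀ x, Q (Sum.inl x) := by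
    refine Pairs.induction_up (fun k hk ↦ ?_) fun i j hij hj ↦ ?_
    · rw [← simpleD_of_lt hk]
      exact h1 _
    · refine h2 ⟨j, by lia⟩ _ _ ?_ ?_
      · rw [simpleD_of_lt hj]
        exact fun he ↦ hij.ne (Pairs.ext_iff.mp (Sum.inl_injective he)).1
      · rw [vecD_simpleD_of_lt hj, corootD_of_lt hj]
        exact subVec_succ_right hij hj
  have hadd : ∀ x, Q (Sum.inr x) := by
    refine Pairs.induction_down (fun i hi ↦ ?_) fun i j hij hj ↦ ?_
    · by_cases hi' : i = m
      · subst hi'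
        rw [← simpleD_last]
        exact h1 _
      · have hi'' : ¬ i = m + 1 := by lia
        -- The last reflection turns `ε_i - ε_m` into `ε_i + ε_{m+1}`.
        refine h2 ⟨m + 1, by lia⟩ _ _ ?_ ?_ (hsub (Pairs.mk i m (by lia) (by lia)))
        · rw [simpleD_last]
          exact Sum.inl_ne_inr
        · rw [vecD_simpleD_last, corootD_last]
          simp only [vecD, Sum.elim_inl, Sum.elim_inr, subVec, addVec, map_sub, coordForm_coordVec,
            hi', hi'', true_or, or_self, if_true, if_false]
          module
    · have hj' : j + 1 < m + 2 := by lia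
      refine h2 ⟨j, by lia⟩ _ _ ?_ ?_
      · rw [simpleD_of_lt hj']
        exact Sum.inr_ne_inl
      · rw [vecD_simpleD_of_lt hj', corootD_of_lt hj']
        exact addVec_pred_right hij hj'
  rcases x with x | x
  · exact hsub x
  · exact hadd x

end Pairs

theorem corootD_vecD_simpleD {m : ℕ} (i j : Fin (m + 3)) :
    corootD j (vecD (simpleD i)) = CartanMatrix.D (m + 3) i j := by
  simp only [CartanMatrix.D, Matrix.of_apply, Fin.ext_iff]
  induction i using lt_or_last_induction with
  | h1 i hi =>
    rw [vecD_simpleD_of_lt hi]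
    induction j using lt_or_last_induction with
    | h1 j hj =>
      rw [corootD_of_lt hj]
      simp only [subVec, adjCoroot, map_sub, coordForm_coordVec]
      split_ifs <;> first | (exfalso; lia) | norm_num
    | h2 =>
      rw [corootD_last]
      simp only [subVec, map_sub, coordForm_coordVec]
      split_ifs <;> first | (exfalso; lia) | norm_num
  | h2 =>
    rw [vecD_simpleD_last]
    induction j using lt_or_last_induction with
    | h1 j hj =>
      rw [corootD_of_lt hj]
      simp only [adjCoroot, map_add, coordForm_coordVec]
      split_ifs <;> first | (exfalso; lia) | norm_num
    | h2 =>
      rw [corootD_last]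
      simp only [map_add, coordForm_coordVec]
      norm_num

theorem eq_top_of_vecD_ne {m : ℕ} (x : Pairs (m + 3) ⊕ Pairs (m + 3))
    (h : ∀ (i : Fin (m + 3)) (y : Pairs (m + 3) ⊕ Pairs (m + 3)),
      vecD y ≠ vecD x + vecD (simpleD i)) :
    x = Sum.inr (Pairs.mk 0 1 (by lia) (by lia)) := by
  have hstep : ∀ (k : ℕ) (hk : k + 1 < m + 3),
    vecD (simpleD (⟨k, by lia⟩ : Fin (m + 3))) = coordVec k - coordVec (k + 1) :=
    fun k hk ↦ vecD_simpleD_of_lt hk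
  rcases x with ⟨⟨j, hj⟩, ⟨i, hi⟩⟩ | ⟨⟨j, hj⟩, ⟨i, hi⟩⟩ <;> simp only at hi
  · exfalso
    by_cases h0 : j < m + 2
    · refine h ⟨j, by lia⟩ (Sum.inl (Pairs.mk i (j + 1) (by lia) (by lia))) ?_
      rw [hstep j (by lia)]
      simp only [vecD, Sum.elim_inl, subVec]
      module
    obtain rfl : j = m + 2 := by lia
    by_cases h1 : i < m + 1
    · refine h ⟨m + 2, by lia⟩ (Sum.inr (Pairs.mk i (m + 1) (by lia) (by lia))) ?_
      rw [vecD_simpleD_last]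
      simp only [vecD, Sum.elim_inl, Sum.elim_inr, subVec, addVec]
      module
    -- The root `ε_{m+1} - ε_{m+2}` is orthogonal to the last simple root, and is extended by `ε_m -
    -- ε_{m+1}` instead. This needs a third coordinate, hence rank at least `3`.
    · obtain rfl : i = m + 1 := by lia
      refine h ⟨m, by lia⟩ (Sum.inl (Pairs.mk m (m + 2) (by lia) (by lia))) ?_
      rw [hstep m (by lia)]
      simp only [vecD, Sum.elim_inl, subVec]
      module
  · by_cases h0 : i = 0
    · by_cases h1 : j = 1
      · exact congrArg Sum.inr (Pairs.ext_iff.mpr ⟨h0, h1⟩)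
      · refine (h ⟨j - 1, by lia⟩
          (Sum.inr (Pairs.mk i (j - 1) (by lia) (by lia))) ?_).elim
        rw [hstep (j - 1) (by lia), Nat.sub_add_cancel (by lia)]
        simp only [vecD, Sum.elim_inr, addVec]
        module
    · refine (h ⟨i - 1, by lia⟩
        (Sum.inr (Pairs.mk (i - 1) j (by lia) (by lia))) ?_).elim
      rw [hstep (i - 1) (by lia), Nat.sub_add_cancel (by lia)]
      simp only [vecD, Sum.elim_inr, addVec]
      module

theorem exists_eq_mul_D {m : ℕ} (g : Fin (m + 3) → ℂ)
    (hg : ∀ i j, CartanMatrix.D (m + 3) i j * g j = CartanMatrix.D (m + 3) j i * g i) :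
    ∃ k, ∀ i, g i = k * 1 := by
  obtain ⟨k, hk⟩ := exists_eq_mul_of_parent (fun _ ↦ 1)
    -- The fork of the diagram: the last node hangs on `m`, as does the node `m + 1`.
    (fun i : Fin (m + 3) ↦ if (i : ℕ) = m + 2 then ⟨m, by lia⟩ else ⟨i - 1, by lia⟩) 0 one_ne_zero
    (fun i ↦ by
      have h : ∀ (k : ℕ) (i : Fin (m + 3)), (i : ℕ) ≤ k →
          (fun i : Fin (m + 3) ↦ if (i : ℕ) = m + 2 then (⟨m, by lia⟩ : Fin (m + 3))
            else ⟨i - 1, by lia⟩)^[k] i = 0 := by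
        intro k
        induction k with
        | zero => exact fun i hi ↦ Fin.ext (Nat.le_zero.mp hi)
        | succ k ih =>
          intro i hi
          rw [Function.iterate_succ_apply]
          refine ih _ ?_
          split_ifs <;> simp only <;> lia
      exact h _ i (by lia))
    (fun i hi ↦ by
      have hi' : (i : ℕ) ≠ 0 := fun h ↦ hi (Fin.ext h)
      simp only [CartanMatrix.D, Matrix.of_apply, Fin.ext_iff]
      by_cases h : (i : ℕ) = m + 2
      · simp only [h, if_true]
        split_ifs <;> first | (exfalso; lia) | norm_num
      · simp only [h, if_false]
        split_ifs <;> first | (exfalso; lia) | norm_num) g hg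
  exact ⟨k, fun i ↦ by rw [hk, Int.cast_one]⟩

/-- The model of the root system of type `D`, with the positive roots `ε_i ± ε_j`. -/
noncomputable def modelD (m : ℕ) : PositiveRootModel (CartanMatrix.D (m + 3)) (ℕ →₀ ℂ)
    (Pairs (m + 3) ⊕ Pairs (m + 3)) 4 (2 * (m + 3 : ℕ) - 4) where
  vec := vecD
  vec_injective := vecD_injective
  simple := simpleD
  coroot := corootD
  coroot_simple := corootD_vecD_simpleD
  exists_reflection := exists_vecD_eq_reflection
  induction_reflection := vecD_induction
  top := Sum.inr (Pairs.mk 0 1 (by lia) (by lia))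
  eq_top := eq_top_of_vecD_ne
  halfSq _ := 1
  halfSq_unique := exists_eq_mul_D
  rhoForm := coordForm fun i ↦ m + 2 - i
  rhoForm_simple i := by
    induction i using lt_or_last_induction with
    | h1 i hi =>
      rw [vecD_simpleD_of_lt hi]
      simp only [subVec, map_sub, coordForm_coordVec]
      push_cast
      ring
    | h2 =>
      rw [vecD_simpleD_last]
      simp only [map_add, coordForm_coordVec]
      push_cast
      ring
  rhoForm_ne_zero := by
    rintro (⟨⟨j, hj⟩, ⟨i, hi⟩⟩ | ⟨⟨j, hj⟩, ⟨i, hi⟩⟩) h <;> simp only at hi <;>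
      simp only [vecD, Sum.elim_inl, Sum.elim_inr, subVec, addVec, map_sub, map_add,
        coordForm_coordVec] at h
    · have : ((j : ℤ) : ℂ) = (i : ℤ) := by push_cast; linear_combination h
      have := Int.cast_injective this
      lia
    · have : ((2 * m + 4 : ℤ) : ℂ) = (i + j : ℤ) := by push_cast; linear_combination h
      have := Int.cast_injective this
      lia
  rhoForm_top := by
    simp only [vecD, Sum.elim_inr, addVec, map_add, coordForm_coordVec]
    push_cast
    ring
  topForm := coordForm fun i ↦ if i < 2 then 1 else 0
  topForm_simple i := by
    induction i using lt_or_last_induction with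
    | h1 i hi =>
      rw [vecD_simpleD_of_lt hi, corootD_of_lt hi]
      simp only [vecD, Sum.elim_inr, subVec, addVec, map_sub, map_add, adjCoroot,
        coordForm_coordVec]
      split_ifs <;> first | (exfalso; lia) | norm_num
    | h2 =>
      rw [vecD_simpleD_last, corootD_last]
      simp only [vecD, Sum.elim_inr, addVec, map_add, coordForm_coordVec]
      split_ifs <;> first | (exfalso; lia) | norm_num
  topForm_top := by
    simp only [vecD, Sum.elim_inr, addVec, map_add, coordForm_coordVec]
    norm_num
  shift := by
    let r : ℤ := 2 * m + 4
    let δ : ℕ → ℤ := fun i ↦ if i < 2 then 2 else 0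
    refine multiset_map_add_eq_of_sum_half
      (Sum.elim
        (fun x : Pairs (m + 3) ↦ δ x.2 - δ x.1 + ((r - 2 * (x.2 : ℕ)) - (r - 2 * (x.1 : ℕ))))
        fun x : Pairs (m + 3) ↦ δ x.2 + δ x.1 + ((r - 2 * (x.2 : ℕ)) + (r - 2 * (x.1 : ℕ))))
      (Sum.elim (fun x : Pairs (m + 3) ↦ (r - 2 * (x.2 : ℕ)) - (r - 2 * (x.1 : ℕ)))
        fun x : Pairs (m + 3) ↦ (r - 2 * (x.2 : ℕ)) + (r - 2 * (x.1 : ℕ)))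
      2 4 (2 * m + 2) (4 * m + 10) (4 * m + 4) (2 * m + 6) ?_ ?_ ?_ ?_ ?_ ?_ ?_ ?_ fun f ↦ ?_
    · have hδ : ∀ i, (if i < 2 then 1 else 0 : ℂ) = (δ i : ℂ) / 2 := fun i ↦ by
        simp only [δ]
        split_ifs <;> norm_num
      rintro (x | x) <;>
        simp only [vecD, Sum.elim_inl, Sum.elim_inr, subVec, addVec, map_sub, map_add,
          coordForm_coordVec, hδ, r] <;>
        (push_cast; ring)
    · rintro (x | x) <;>
        simp only [vecD, Sum.elim_inl, Sum.elim_inr, subVec, addVec, map_sub, map_add,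
          coordForm_coordVec, r] <;>
        (push_cast; ring)
    · norm_num
    · norm_num
    · push_cast; ring
    · push_cast; ring
    · push_cast; ring
    · push_cast; ring
    · rw [Fintype.sum_sum_type]
      simp only [Sum.elim_inl, Sum.elim_inr, δ]
      rw [sum_pairs_shift_sub, sum_pairs_shift_add]
      simp only [r]
      push_cast
      ring_nf

end UniversalCasimir

/-! ### The theorem, type by type. -/

theorem theorem2 {𝔤 : Type*} [LieRing 𝔤] [LieAlgebra ℂ 𝔤] [FiniteDimensional ℂ 𝔤]
    [LieAlgebra.IsSimple ℂ 𝔤] (𝔥 : LieSubalgebra ℂ 𝔤) [𝔥.IsCartanSubalgebra]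
    (b : (LieAlgebra.IsKilling.rootSystem 𝔥).Base)
    (θ : 𝔥.root) (hθ : UniversalCasimir.IsMaximalRoot b θ)
    (lam : Module.Dual ℂ 𝔥) (hlam : lam = (LieAlgebra.IsKilling.rootSystem 𝔥).root θ)
    (X : UniversalCasimir.SimpleType) (hX : UniversalCasimir.HasType b X)
    (α β γ t : ℂ) (hα : α = X.vogelα) (hβ : β = X.vogelβ) (hγ : γ = X.vogelγ)
    (ht : t = α + β + γ) :
    -- the generating function
    (∀ᶠ z in nhds (0 : ℂ),
      DifferentiableAt ℂ (fun w => Complex.log (UniversalCasimir.universalRatio α β γ w)) z ∧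
      HasSum (fun k : ℕ => UniversalCasimir.casimir b lam k * z ^ k)
        (-2 * z *
          deriv (fun w => Complex.log (UniversalCasimir.universalRatio α β γ w)) z)) ∧
    -- the first two values
    UniversalCasimir.casimir b lam 1 = 1 ∧
    UniversalCasimir.casimir b lam 2 =
      (2 * t ^ 3 + 3 * t * (α ^ 2 + β ^ 2 + γ ^ 2) - (α ^ 3 + β ^ 3 + γ ^ 3)) / (16 * t ^ 3) ∧
    -- the limits at infinity and the dimension formula
    Filter.Tendsto (UniversalCasimir.rootRatio b (UniversalCasimir.minimalForm θ) lam)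
      (Bornology.cobounded ℂ) (nhds ((Module.finrank ℂ 𝔤 : ℂ) ^ 2)) ∧
    Filter.Tendsto (UniversalCasimir.universalRatio α β γ)
      (Bornology.cobounded ℂ) (nhds ((Module.finrank ℂ 𝔤 : ℂ) ^ 2)) ∧
    (Module.finrank ℂ 𝔤 : ℂ) = ((α - 2 * t) * (β - 2 * t) * (γ - 2 * t)) / (α * β * γ) := by
  obtain ⟨e, he⟩ := hX
  obtain rfl : α = -2 := hα
  have hcard : ∀ N : ℕ, (Fintype.card (UniversalCasimir.Pairs N) : ℂ) = ((N : ℂ) ^ 2 - N) / 2 :=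
    fun N ↦ by
      have h : ((2 * Fintype.card (UniversalCasimir.Pairs N) + N : ℕ) : ℂ) = (N ^ 2 : ℕ) := by
        rw [UniversalCasimir.Pairs.card_add]
      push_cast at h
      linear_combination h / 2
  cases X with
  | A n hn =>
    obtain ⟨m, rfl⟩ : ∃ m, n = m + 1 := ⟨n - 1, by lia⟩
    obtain rfl : β = 2 := hβ
    obtain rfl : γ = ((m + 1 : ℕ) : ℂ) + 1 := hγ
    -- Here and in the other classical types, `t` and `γ` are written as casts of natural numbers,
    -- so that they are nonzero because those numbers are.
    have ht0 : t = (m + 2 : ℕ) := by rw [ht]; push_cast; ring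
    have hγ0 : ((m + 1 : ℕ) : ℂ) + 1 = ((m + 2 : ℕ) : ℂ) := by push_cast; ring
    refine (UniversalCasimir.modelA m).universal e he hθ hlam ht ?_ (by norm_num) ?_ ?_
    · rw [ht0, Nat.cast_ne_zero]
      lia
    · rw [hγ0, Nat.cast_ne_zero]
      lia
    · have hγ1 : ((m + 2 : ℕ) : ℂ) ≠ 0 := Nat.cast_ne_zero.mpr (by lia)
      rw [hγ0, ht0, eq_div_iff (mul_ne_zero (by norm_num) hγ1)]
      push_cast [UniversalCasimir.SimpleType.rank, Fintype.card_sum, Fintype.card_fin, hcard]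
      ring
  | B n hn =>
    obtain ⟨m, rfl⟩ : ∃ m, n = m + 2 := ⟨n - 2, by lia⟩
    obtain rfl : β = 4 := hβ
    obtain rfl : γ = 2 * ((m + 2 : ℕ) : ℂ) - 3 := hγ
    have ht0 : t = (2 * m + 3 : ℕ) := by rw [ht]; push_cast; ring
    have hγ0 : 2 * ((m + 2 : ℕ) : ℂ) - 3 = ((2 * m + 1 : ℕ) : ℂ) := by push_cast; ring
    refine (UniversalCasimir.modelB m).universal e he hθ hlam ht ?_ (by norm_num) ?_ ?_
    · rw [ht0, Nat.cast_ne_zero]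
      lia
    · rw [hγ0, Nat.cast_ne_zero]
      lia
    · have hγ1 : ((2 * m + 1 : ℕ) : ℂ) ≠ 0 := Nat.cast_ne_zero.mpr (by lia)
      rw [hγ0, ht0, eq_div_iff (mul_ne_zero (by norm_num) hγ1)]
      push_cast [UniversalCasimir.SimpleType.rank, Fintype.card_sum, Fintype.card_fin, hcard]
      ring
  | C n hn =>
    obtain ⟨m, rfl⟩ : ∃ m, n = m + 2 := ⟨n - 2, by lia⟩
    obtain rfl : β = 1 := hβ
    obtain rfl : γ = ((m + 2 : ℕ) : ℂ) + 2 := hγ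
    have ht0 : t = (m + 3 : ℕ) := by rw [ht]; push_cast; ring
    have hγ0 : ((m + 2 : ℕ) : ℂ) + 2 = ((m + 4 : ℕ) : ℂ) := by push_cast; ring
    refine (UniversalCasimir.modelC m).universal e he hθ hlam ht ?_ (by norm_num) ?_ ?_
    · rw [ht0, Nat.cast_ne_zero]
      lia
    · rw [hγ0, Nat.cast_ne_zero]
      lia
    · have hγ1 : ((m + 4 : ℕ) : ℂ) ≠ 0 := Nat.cast_ne_zero.mpr (by lia)
      rw [hγ0, ht0, eq_div_iff (mul_ne_zero (by norm_num) hγ1)]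
      push_cast [UniversalCasimir.SimpleType.rank, Fintype.card_sum, Fintype.card_fin, hcard]
      ring
  | D n hn =>
    obtain ⟨m, rfl⟩ : ∃ m, n = m + 3 := ⟨n - 3, by lia⟩
    obtain rfl : β = 4 := hβ
    obtain rfl : γ = 2 * ((m + 3 : ℕ) : ℂ) - 4 := hγ
    have ht0 : t = (2 * m + 4 : ℕ) := by rw [ht]; push_cast; ring
    have hγ0 : 2 * ((m + 3 : ℕ) : ℂ) - 4 = ((2 * m + 2 : ℕ) : ℂ) := by push_cast; ring
    refine (UniversalCasimir.modelD m).universal e he hθ hlam ht ?_ (by norm_num) ?_ ?_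
    · rw [ht0, Nat.cast_ne_zero]
      lia
    · rw [hγ0, Nat.cast_ne_zero]
      lia
    · have hγ1 : ((2 * m + 2 : ℕ) : ℂ) ≠ 0 := Nat.cast_ne_zero.mpr (by lia)
      rw [hγ0, ht0, eq_div_iff (mul_ne_zero (by norm_num) hγ1)]
      push_cast [UniversalCasimir.SimpleType.rank, Fintype.card_sum, Fintype.card_fin, hcard]
      ring
  | G₂ =>
    obtain rfl : β = 10 / 3 := hβ
    obtain rfl : γ = 8 / 3 := hγ
    refine (UniversalCasimir.isPositiveRootTable_G₂.model (by norm_num) (by norm_num) (by norm_num)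
      UniversalCasimir.exists_eq_mul_G₂).universal e he hθ hlam ht ?_ (by norm_num) (by norm_num) ?_
    · rw [ht]
      norm_num
    -- The dimension count: `2 + 2 * 6 = 14`.
    · rw [ht, Fintype.card_fin, show UniversalCasimir.tableG₂.length = 6 from rfl]
      norm_num
  | F₄ =>
    obtain rfl : β = 5 := hβ
    obtain rfl : γ = 6 := hγ
    refine (UniversalCasimir.isPositiveRootTable_F₄.model (by norm_num) (by norm_num) (by norm_num)
      UniversalCasimir.exists_eq_mul_F₄).universal e he hθ hlam ht ?_ (by norm_num) (by norm_num) ?_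
    · rw [ht]
      norm_num
    · rw [ht, Fintype.card_fin, show UniversalCasimir.tableF₄.length = 24 from rfl]
      norm_num
  | E₆ =>
    obtain rfl : β = 6 := hβ
    obtain rfl : γ = 8 := hγ
    refine (UniversalCasimir.isPositiveRootTable_E₆.model (by norm_num) (by norm_num) (by norm_num)
      UniversalCasimir.exists_eq_mul_E₆).universal e he hθ hlam ht ?_ (by norm_num) (by norm_num) ?_
    · rw [ht]
      norm_num
    · rw [ht, Fintype.card_fin, show UniversalCasimir.tableE₆.length = 36 from rfl]
      norm_num
  | E₇ =>
    obtain rfl : β = 8 := hβ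
    obtain rfl : γ = 12 := hγ
    refine (UniversalCasimir.isPositiveRootTable_E₇.model (by norm_num) (by norm_num) (by norm_num)
      UniversalCasimir.exists_eq_mul_E₇).universal e he hθ hlam ht ?_ (by norm_num) (by norm_num) ?_
    · rw [ht]
      norm_num
    · rw [ht, Fintype.card_fin, show UniversalCasimir.tableE₇.length = 63 from rfl]
      norm_num
  | E₈ =>
    obtain rfl : β = 12 := hβ
    obtain rfl : γ = 20 := hγ
    refine (UniversalCasimir.isPositiveRootTable_E₈.model (by norm_num) (by norm_num) (by norm_num)
      UniversalCasimir.exists_eq_mul_E₈).universal e he hθ hlam ht ?_ (by norm_num) (by norm_num) ?_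
    · rw [ht]
      norm_num
    · rw [ht, Fintype.card_fin, show UniversalCasimir.tableE₈.length = 120 from rfl]
      norm_num
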